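/- Let $I=[\tfrac12,1]\cup\{\infty\}$, let $\Phi:I\times[0,1]\to I$ be given by $\Phi(x;u)=x$ if $x>u$ and $\Phi(x;u)=\infty$ otherwise, and let $\nu$ be the probability measure on $I$ with $\nu(dx)=\frac{dx}{2x^2}$ on $(\tfrac12,1)$ and $\nu(\{\infty\})=\tfrac12$. Consider the frozen percolation recursive distributional equation $$Y\stackrel{d}{=}\Phi(Y_1\wedge Y_2;U),$$ with $Y_1,Y_2$ i.i.d. copies of $Y$, independent of $U\sim\mathrm{Uniform}[0,1]$. Let $\mathcal V$ be the set of finite words $\mathbf i$ over a two-letter alphabet (the rooted binary tree), and $|\mathbf i|$ the length of $\mathbf i$. An \emph{invariant recursive tree process} associated with this equation, with marginal $\nu$, is a family $(Y_{\mathbf i})_{\mathbf i\in\mathcal V}$ of $I$-valued random variables, defined on a common probability space with i.i.d. $\mathrm{Uniform}[0,1]$ variables $(U_{\mathbf i})_{\mathbf i\in\mathcal V}$, such that every $Y_{\mathbf i}$ has law $\nu$; for each $d\ge 0$ the variables $(Y_{\mathbf i})_{|\mathbf i|=d}$ are independent, and this family is independent of $(U_{\mathbf i})_{|\mathbf i|<d}$;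 and $Y_{\mathbf i}=\Phi(Y_{\mathbf i1}\wedge Y_{\mathbf i2};U_{\mathbf i})$ almost surely for every $\mathbf i$. A $\sigma$-algebra is trivial if each of its events has probability $0$ or $1$. \textbf{Theorem.} (1) For every such invariant recursive tree process the tail $\sigma$-algebra $\bigcap_{n\ge 0}\sigma(Y_{\mathbf i}:|\mathbf i|\ge n)$ is trivial. (2) Consequently, Aldous' construction of frozen percolation on the infinite $3$-regular tree $\mathscr T_3$ has trivial tail, in the following sense. Let $(U_e)$ be i.i.d. $\mathrm{Uniform}[0,1]$ weights of the edges of $\mathscr T_3$, and let $(Y_{\vec e})$ be $I$-valued random variables of law $\nu$ indexed by the directed edges, such that $Y_{\vec e}=\Phi(Y_{\vec e_1}\wedge Y_{\vec e_2};U_e)$ almost surely, where $\vec e_1,\vec e_2$ are the two directed edges that continue $\vec e$, and such that for every vertex $o$ and every $n\ge 0$ the variables $Y_{\vec e}$ of the directed edges $\vec e$ pointing away from $o$ and starting at distance $n$ from $o$ are independent, and this family is independent of the weights of the edges inside the ball of radius $n$ about $o$. For a vertex $o$ let $\mathcal H_n(o)$ be the $\sigma$-algebra generated by all $U_e$ and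 $Y_{\vec e}$ with $\vec e$ pointing away from $o$ and starting at distance at least $n$ from $o$. Then for every vertex $o$ the $\sigma$-algebra $\bigcap_{n\ge0}\mathcal H_n(o)$ is trivial. -/

import Mathlib

open MeasureTheory ProbabilityTheory
open scoped ENNReal

noncomputable section

namespace FrozenPercolation

/-! ### Invariant recursive tree processes and their tails -/

/-- Vertices are finite words over `ι`; the children of the word `i` are the words `i ++ [j]`.
The map `g`, the law `κ` of the innovation and the index set `ι` of the children encode the
recursive distributional equation `X =ᵈ g (ξ, (X_j)_{j ∈ ι})`; the process `X` with innovations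
`ξ` is an invariant recursive tree process for it with marginal `μ`. -/
structure IsInvariantRTP {Ω S Ξ ι : Type*} [MeasurableSpace Ω] [MeasurableSpace S]
    [MeasurableSpace Ξ] (P : Measure Ω) (g : Ξ → (ι → S) → S) (κ : Measure Ξ) (μ : Measure S)
    (ξ : List ι → Ω → Ξ) (X : List ι → Ω → S) : Prop where
  measurable_innovation : ∀ i, Measurable (ξ i)
  measurable_process : ∀ i, Measurable (X i)
  /-- the innovations are i.i.d. with law `κ` -/
  law_innovation : ∀ i, P.map (ξ i) = κ
  indep_innovation : iIndepFun ξ P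
  /-- every `X i` has law `μ` -/
  law_process : ∀ i, P.map (X i) = μ
  /-- the variables of one generation are independent -/
  indep_generation : ∀ d : ℕ, iIndepFun (fun (i : {i : List ι // i.length = d}) => X i.1) P
  /-- the recursion -/
  recursion : ∀ i, ∀ᵐ ω ∂P, X i ω = g (ξ i ω) (fun j => X (i ++ [j]) ω)
  /-- generation `d` is independent of the innovations of all earlier generations -/
  indep_earlier : ∀ d : ℕ,
    IndepFun (fun ω (i : {i : List ι // i.length = d}) => X i.1 ω)
      (fun ω (i : {i : List ι // i.length < d}) => ξ i.1 ω) P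

/-- The tail `⋂ n, σ(X i : |i| ≥ n)`. -/
@[reducible] def rtpTail {Ω S ι : Type*} [MeasurableSpace S] (X : List ι → Ω → S) : MeasurableSpace Ω :=
  ⨅ n : ℕ, ⨆ (i : List ι) (_ : n ≤ i.length), MeasurableSpace.comap (X i) inferInstance

/-- Every event of the σ-algebra `m` has probability `0` or `1`. -/
def IsTrivialUnder {Ω : Type*} [MeasurableSpace Ω] (P : Measure Ω) (m : MeasurableSpace Ω) :
    Prop :=
  ∀ A : Set Ω, MeasurableSet[m] A → P A = 0 ∨ P A = 1

/-! ### The frozen percolation recursion -/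

/-- `I = [1/2, 1] ∪ {∞}`. -/
abbrev I : Type := {x : ℝ≥0∞ // x ∈ Set.Icc (1 / 2 : ℝ≥0∞) 1 ∨ x = ⊤}

/-- The point `∞` of `I`. -/
def I.infty : I := ⟨⊤, Or.inr rfl⟩

open Classical in
/-- `Φ(x; u) = x` if `x > u`, and `∞` otherwise. -/
def Φ (x : I) (u : unitInterval) : I :=
  if ENNReal.ofReal (u : ℝ) < (x : ℝ≥0∞) then x else I.infty

/-- The right-hand side `Φ(Y₁ ∧ Y₂; U)` of the frozen percolation equation. -/
def frozenMap (u : unitInterval) (y : Fin 2 → I) : I := Φ (min (y 0) (y 1)) u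

/-- `ν(dx) = dx / (2 x²)` on `(1/2, 1)` and `ν {∞} = 1/2`. -/
def ν : Measure I :=
  Measure.comap Subtype.val
    ((((volume : Measure ℝ).restrict (Set.Ioo (1 / 2) 1)).withDensity
        (fun x => ENNReal.ofReal (1 / (2 * x ^ 2)))).map ENNReal.ofReal
      + (1 / 2 : ℝ≥0∞) • Measure.dirac (⊤ : ℝ≥0∞))

/-! ### Aldous' construction on the 3-regular tree -/

/-- The directed edge `d` points away from the vertex `o` and starts at distance `n` from it. -/
def IsOutward {V : Type*} (G : SimpleGraph V) (o : V) (n : ℕ) (d : G.Dart) : Prop :=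
  G.dist o d.fst = n ∧ G.dist o d.snd = n + 1

/-- The joint law of the edge weights `U` and of the times `Y` attached to the directed edges
in Aldous' construction of frozen percolation on a 3-regular tree `G`. -/
structure IsAldousConstruction {Ω V : Type*} [MeasurableSpace Ω] (P : Measure Ω)
    (G : SimpleGraph V) (U : G.edgeSet → Ω → unitInterval) (Y : G.Dart → Ω → I) : Prop where
  measurable_weight : ∀ e, Measurable (U e)
  measurable_time : ∀ d, Measurable (Y d)
  /-- the edge weights are i.i.d. uniform on `[0, 1]` -/
  law_weight : ∀ e, P.map (U e) = volume
  indep_weight : iIndepFun U P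
  law_time : ∀ d, P.map (Y d) = ν
  /-- `d₁` and `d₂` are the two directed edges that continue `d` -/
  recursion : ∀ d d₁ d₂ : G.Dart, d₁.fst = d.snd → d₂.fst = d.snd →
    d₁ ≠ d.symm → d₂ ≠ d.symm → d₁ ≠ d₂ →
    ∀ᵐ ω ∂P, Y d ω = Φ (min (Y d₁ ω) (Y d₂ ω)) (U ⟨d.edge, d.edge_mem⟩ ω)
  /-- the times attached to the directed edges leaving a ball are independent -/
  indep_sphere : ∀ (o : V) (n : ℕ),
    iIndepFun (fun (d : {d : G.Dart // IsOutward G o n d}) => Y d.1) P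
  /-- and they are independent of the weights of the edges inside the ball -/
  indep_inside : ∀ (o : V) (n : ℕ),
    IndepFun (fun ω (d : {d : G.Dart // IsOutward G o n d}) => Y d.1 ω)
      (fun ω (e : {e : G.edgeSet // ∀ v ∈ e.1, G.dist o v ≤ n}) => U e.1 ω) P

/-- The tail, seen from `o`, of the construction: the intersection over `n` of the σ-algebras
generated by the weights of the edges outside the ball of radius `n` about `o` and by the times
attached to these edges, directed away from `o`. -/
@[reducible] def aldousTail {Ω V : Type*} (G : SimpleGraph V) (U : G.edgeSet → Ω → unitInterval)
    (Y : G.Dart → Ω → I) (o : V) : MeasurableSpace Ω :=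
  ⨅ n : ℕ, ⨆ (m : ℕ) (_ : n ≤ m) (d : G.Dart) (_ : IsOutward G o m d),
    MeasurableSpace.comap (Y d) inferInstance ⊔
      MeasurableSpace.comap (U ⟨d.edge, d.edge_mem⟩) inferInstance

end FrozenPercolation

end

/-!
Let `H` be the tail. It is enough to show that the time `Y i` of every node `i` is independent of
`H` together with the other times of the level of `i` and the weights above that level: then `H` is
independent of every level, hence of everything, hence of itself
(`IsFrozenForest.isTrivialUnder_tail`).

To see this, consider the conditional survival function `p x` of `Y i` given the times `k` levels
further down. As the weight of a node is independent of everything below and beside it, averaging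
over the weights shows that `p` arises from the survival functions `p₁` and `p₂` of the two children
of `i` by the deterministic map `p = T (p₁ p₂)`, `T r x = 1/2 + x r(x) - ∫_{1/2}^x r` (`step`), and
that conditioning on further variables outside the subtree of `i` does not change `p`
(`IsFrozenForest.integral_exceed_mul`). It remains to be shown that `p x` converges in `L²` to its
mean `a x = 1 / (2 x)`, the survival function of `ν`.

This holds because the recursion contracts variances (`step_contraction`). The functions `p₁` and
`p₂` are independent with mean `a`, and `a = T (a²)`, so that `p - a = x w - ∫ w` with
`w = p₁ p₂ - a²`. If `v₁` and `v₂` are the variances of `p₁ x` and `p₂ x`, and `v` is the larger of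
them, then `E w² = v₁ v₂ + a² (v₁ + v₂) ≤ 3 a² v`, since a variable with values in `[0, 1]` and mean
`a ≥ 1/2` has variance at most `a (1 - a) ≤ a²`. Hence the term `x w` has second moment at most
`3 x² a² v = 3/4 v`. The integral term is of Volterra type, and a weight `exp (-150 x)` makes it
small enough for the total factor to be less than `1`.

The argument uses only the independence structure of a forest of binary trees (`IsFrozenForest`).
Words over two letters are such a forest, and so are the edges of a 3-regular tree directed away
from a vertex `o`, since in a tree every vertex except `o` has exactly one neighbour closer to `o`.
-/

namespace FrozenPercolation

/-! ### The law `ν` and one step of the recursion -/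

/-- The indicator of the event `x < y`, for a time `y ∈ I` and a real threshold `x`. -/
noncomputable def exceed (x : ℝ) (y : I) : ℝ :=
  {y : I | ENNReal.ofReal x < (y : ℝ≥0∞)}.indicator 1 y

lemma measurableSet_exceed (x : ℝ) : MeasurableSet {y : I | ENNReal.ofReal x < (y : ℝ≥0∞)} :=
  measurableSet_lt measurable_const measurable_subtype_coe

lemma measurable_exceed_uncurry : Measurable (fun p : ℝ × I => exceed p.1 p.2) := by
  have : (fun p : ℝ × I => exceed p.1 p.2)
      = {p : ℝ × I | ENNReal.ofReal p.1 < (p.2 : ℝ≥0∞)}.indicator 1 := by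
    ext p; simp [exceed, Set.indicator]
  rw [this]
  exact measurable_one.indicator (measurableSet_lt
    (ENNReal.measurable_ofReal.comp measurable_fst) (measurable_subtype_coe.comp measurable_snd))

lemma exceed_eq_one {x : ℝ} {y : I} (h : ENNReal.ofReal x < (y : ℝ≥0∞)) : exceed x y = 1 :=
  Set.indicator_of_mem (s := {y : I | ENNReal.ofReal x < (y : ℝ≥0∞)}) h _

lemma exceed_eq_zero {x : ℝ} {y : I} (h : ¬ ENNReal.ofReal x < (y : ℝ≥0∞)) : exceed x y = 0 :=
  Set.indicator_of_notMem (s := {y : I | ENNReal.ofReal x < (y : ℝ≥0∞)}) h _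

lemma exceed_nonneg (x : ℝ) (y : I) : 0 ≤ exceed x y :=
  Set.indicator_nonneg (fun _ _ => zero_le_one) y

lemma exceed_le_one (x : ℝ) (y : I) : exceed x y ≤ 1 :=
  Set.indicator_le_self' (fun _ _ => zero_le_one) y

lemma exceed_antitone (y : I) : Antitone (fun x => exceed x y) := by
  intro s t hst
  simp only [exceed, Set.indicator, Set.mem_ofPred_eq, Pi.one_apply]
  split_ifs with h1 h2
  · exact le_rfl
  · exact absurd ((ENNReal.ofReal_le_ofReal hst).trans_lt h1) h2
  · exact zero_le_one
  · exact le_rfl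

lemma exceed_min (x : ℝ) (y z : I) : exceed x (min y z) = exceed x y * exceed x z := by
  have : ((min y z : I) : ℝ≥0∞) = min (y : ℝ≥0∞) z := by
    rcases le_total y z with h | h
    · rw [min_eq_left h, min_eq_left (show (y : ℝ≥0∞) ≤ z from h)]
    · rw [min_eq_right h, min_eq_right (show (z : ℝ≥0∞) ≤ y from h)]
  simp only [exceed, Set.indicator, Set.mem_ofPred_eq, Pi.one_apply, this, lt_min_iff]
  split_ifs <;> simp_all

lemma half_eq_ofReal : (1 / 2 : ℝ≥0∞) = ENNReal.ofReal (1 / 2) := by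
  rw [ENNReal.ofReal_div_of_pos (by norm_num)]; simp

lemma nu_exceed {x : ℝ} (hx : x ∈ Set.Icc (1 / 2 : ℝ) 1) :
    ν {y : I | ENNReal.ofReal x < (y : ℝ≥0∞)} = ENNReal.ofReal (1 / (2 * x)) := by
  have hx0 : 0 < x := by linarith [hx.1]
  have hI : MeasurableSet {x : ℝ≥0∞ | x ∈ Set.Icc (1 / 2 : ℝ≥0∞) 1 ∨ x = ⊤} :=
    measurableSet_Icc.union (measurableSet_singleton _)
  have himg : (Subtype.val '' {y : I | ENNReal.ofReal x < (y : ℝ≥0∞)})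
      = {t : ℝ≥0∞ | ENNReal.ofReal x < t ∧ (t ∈ Set.Icc (1 / 2 : ℝ≥0∞) 1 ∨ t = ⊤)} := by
    ext t
    constructor
    · rintro ⟨y, hy, rfl⟩; exact ⟨hy, y.2⟩
    · rintro ⟨h1, h2⟩; exact ⟨⟨t, h2⟩, h1, rfl⟩
  have hmeas : MeasurableSet
      {t : ℝ≥0∞ | ENNReal.ofReal x < t ∧ (t ∈ Set.Icc (1 / 2 : ℝ≥0∞) 1 ∨ t = ⊤)} :=
    (measurableSet_lt measurable_const measurable_id).inter hI
  have hpre : ENNReal.ofReal ⁻¹'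
      {t : ℝ≥0∞ | ENNReal.ofReal x < t ∧ (t ∈ Set.Icc (1 / 2 : ℝ≥0∞) 1 ∨ t = ⊤)}
      ∩ Set.Ioo (1 / 2) 1 = Set.Ioo x 1 := by
    have h2 := half_eq_ofReal
    have h1 : (1 : ℝ≥0∞) = ENNReal.ofReal 1 := by simp
    ext t
    simp only [Set.mem_inter_iff, Set.mem_preimage, Set.mem_ofPred_eq, Set.mem_Ioo, Set.mem_Icc]
    constructor
    · rintro ⟨⟨h, -⟩, h3, h4⟩
      exact ⟨(ENNReal.ofReal_lt_ofReal_iff (by linarith)).1 h, h4⟩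
    · rintro ⟨h, h4⟩
      have : 1 / 2 < t := hx.1.trans_lt h
      refine ⟨⟨(ENNReal.ofReal_lt_ofReal_iff (by linarith)).2 h, Or.inl ⟨?_, ?_⟩⟩, this, h4⟩
      · rw [h2]; exact ENNReal.ofReal_le_ofReal this.le
      · rw [h1]; exact ENNReal.ofReal_le_ofReal h4.le
  have hint : ∫⁻ t in Set.Ioo x 1, ENNReal.ofReal (1 / (2 * t ^ 2))
      = ENNReal.ofReal (1 / (2 * x) - 1 / 2) := by
    have hder : ∀ t ∈ Set.uIcc x 1,
        HasDerivAt (fun t : ℝ => - (1 / (2 * t))) (1 / (2 * t ^ 2)) t := by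
      intro t ht
      rw [Set.uIcc_of_le hx.2] at ht
      have ht0 : t ≠ 0 := by linarith [ht.1]
      have := ((hasDerivAt_inv ht0).const_mul (1 / 2 : ℝ)).neg
      refine (this.congr_of_eventuallyEq (.of_forall fun s => ?_)).congr_deriv ?_
      · simp [mul_comm]
      · field_simp
    have hcont : ContinuousOn (fun t : ℝ => 1 / (2 * t ^ 2)) (Set.uIcc x 1) := by
      intro t ht
      rw [Set.uIcc_of_le hx.2] at ht
      have ht0 : t ≠ 0 := by linarith [ht.1]
      exact ContinuousAt.continuousWithinAt (by fun_prop (disch := positivity))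
    have hii := hcont.intervalIntegrable (μ := volume)
    rw [← ofReal_integral_eq_lintegral_ofReal]
    · rw [← integral_Ioc_eq_integral_Ioo, ← intervalIntegral.integral_of_le hx.2,
        intervalIntegral.integral_eq_sub_of_hasDerivAt hder hii]
      congr 1; ring
    · exact ((intervalIntegrable_iff_integrableOn_Ioc_of_le hx.2).1 hii).mono_set
        Set.Ioo_subset_Ioc_self
    · filter_upwards with t
      positivity
  have hemb : MeasurableEmbedding (Subtype.val : I → ℝ≥0∞) := MeasurableEmbedding.subtype_coe hI
  rw [ν, hemb.comap_apply, himg, Measure.add_apply,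
    Measure.map_apply ENNReal.measurable_ofReal hmeas,
    withDensity_apply _ (ENNReal.measurable_ofReal hmeas),
    Measure.restrict_restrict (ENNReal.measurable_ofReal hmeas), hpre, hint, Measure.smul_apply,
    Measure.dirac_apply' _ hmeas, Set.indicator_of_mem (by simp)]
  have : (1 / 2 : ℝ≥0∞) • (1 : ℝ≥0∞ → ℝ≥0∞) ⊤ = ENNReal.ofReal (1 / 2) := by
    rw [← half_eq_ofReal, smul_eq_mul, Pi.one_apply, mul_one]
  rw [this, ← ENNReal.ofReal_add _ (by norm_num)]
  · congr 1; ring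
  · rw [sub_nonneg]
    exact one_div_le_one_div_of_le (by linarith) (by linarith [hx.2])

/-- The events `{x < y}` with a real threshold `x ∈ [1/2, 1]` generate the σ-algebra of `I`. -/
lemma generateFrom_exceed : (inferInstance : MeasurableSpace I) = MeasurableSpace.generateFrom
    {s | ∃ x ∈ Set.Icc (1 / 2 : ℝ) 1, {y : I | ENNReal.ofReal x < (y : ℝ≥0∞)} = s} := by
  apply le_antisymm
  · have h : (inferInstance : MeasurableSpace I)
        = MeasurableSpace.comap Subtype.val (MeasurableSpace.generateFrom (Set.range Set.Ioi)) := by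
      rw [← borel_eq_generateFrom_Ioi ℝ≥0∞, ← BorelSpace.measurable_eq]; rfl
    rw [h, MeasurableSpace.comap_generateFrom]
    apply MeasurableSpace.generateFrom_le
    rintro _ ⟨_, ⟨t, rfl⟩, rfl⟩
    have key : ∀ x ∈ Set.Icc (1 / 2 : ℝ) 1, MeasurableSet[MeasurableSpace.generateFrom
        {s | ∃ x ∈ Set.Icc (1 / 2 : ℝ) 1, {y : I | ENNReal.ofReal x < (y : ℝ≥0∞)} = s}]
        {y : I | ENNReal.ofReal x < (y : ℝ≥0∞)} :=
      fun x hx => MeasurableSpace.measurableSet_generateFrom ⟨x, hx, rfl⟩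
    have h2 := half_eq_ofReal
    rcases lt_or_ge t (1 / 2) with h | h
    · convert MeasurableSet.univ
      ext ⟨y, hy⟩
      simp only [Set.mem_preimage, Set.mem_Ioi, Set.mem_univ, iff_true]
      rcases hy with hy | rfl
      · exact h.trans_le hy.1
      · exact h.trans_le le_top
    rcases le_or_gt t 1 with h1 | h1
    · have ht : t ≠ ⊤ := ne_top_of_le_ne_top ENNReal.one_ne_top h1
      convert key t.toReal ⟨?_, ?_⟩
      · ext y; simp [ENNReal.ofReal_toReal ht]
      · rw [h2] at h
        exact (ENNReal.ofReal_le_iff_le_toReal ht).1 h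
      · simpa using ENNReal.toReal_mono ENNReal.one_ne_top h1
    rcases eq_or_ne t ⊤ with rfl | ht
    · convert MeasurableSet.empty
      ext y; simp
    · convert key 1 (by norm_num)
      ext ⟨y, hy⟩
      simp only [Set.mem_preimage, Set.mem_Ioi, ENNReal.ofReal_one, Set.mem_ofPred_eq]
      rcases hy with hy | rfl
      · exact ⟨fun h => absurd (h.trans_le hy.2) (not_lt.2 h1.le),
          fun h => absurd h (not_lt.2 hy.2)⟩
      · simp [ht.lt_top]
  · apply MeasurableSpace.generateFrom_le
    rintro _ ⟨x, -, rfl⟩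
    exact measurableSet_exceed x

lemma isPiSystem_exceed : IsPiSystem
    {s | ∃ x ∈ Set.Icc (1 / 2 : ℝ) 1, {y : I | ENNReal.ofReal x < (y : ℝ≥0∞)} = s} := by
  rintro _ ⟨x, hx, rfl⟩ _ ⟨y, hy, rfl⟩ -
  refine ⟨max x y, ⟨hx.1.trans (le_max_left _ _), max_le hx.2 hy.2⟩, ?_⟩
  ext z
  simp [(ENNReal.ofReal_mono).map_max]

/-- The conditional law of `Φ(M; U)` given `M`, in terms of survival functions: if `r` is the
conditional survival function of `M`, then `step r` is that of `Φ(M; U)`. -/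
noncomputable def step (r : ℝ → ℝ) (x : ℝ) : ℝ :=
  1 / 2 + x * r x - ∫ s in Set.Ioc (1 / 2) x, r s

lemma measurable_frozen : Measurable (fun p : I × unitInterval => Φ p.1 p.2) := by
  unfold Φ
  refine Measurable.ite (measurableSet_lt ?_ ?_) measurable_fst measurable_const
  · exact ENNReal.measurable_ofReal.comp (measurable_subtype_coe.comp measurable_snd)
  · exact measurable_subtype_coe.comp measurable_fst

lemma integral_exceed_frozen (m : I) {x : ℝ} (hx : x ∈ Set.Icc (1 / 2 : ℝ) 1) :
    ∫ u, exceed x (Φ m u) = step (fun s => exceed s m) x := by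
  have hx0 : 0 < x := by linarith [hx.1]
  -- if `x < m`, then both `m` and `∞` exceed `x`; otherwise only `∞` does, which is the value for
  -- `m ≤ u`
  by_cases hm : ENNReal.ofReal x < (m : ℝ≥0∞)
  · have h1 : ∀ u, exceed x (Φ m u) = 1 := by
      intro u
      refine Set.indicator_of_mem ?_ _
      simp only [Φ, Set.mem_ofPred_eq]
      split_ifs
      · exact hm
      · exact ENNReal.ofReal_lt_top
    have h2 : ∀ s ∈ Set.Ioc (1 / 2) x, exceed s m = 1 := fun s hs =>
      exceed_eq_one ((ENNReal.ofReal_le_ofReal hs.2).trans_lt hm)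
    have h3 : exceed x m = 1 := exceed_eq_one hm
    simp only [h1, step, h3]
    rw [setIntegral_congr_fun measurableSet_Ioc h2]
    simp only [integral_const, measureReal_def, measure_univ, ENNReal.toReal_one, smul_eq_mul,
      Measure.restrict_apply_univ, Real.volume_Ioc]
    rw [ENNReal.toReal_ofReal (by linarith [hx.1])]; ring
  · have hmt : (m : ℝ≥0∞) ≠ ⊤ := by
      intro h; rw [h] at hm; exact hm ENNReal.ofReal_lt_top
    have hmI : (m : ℝ≥0∞) ∈ Set.Icc (1 / 2 : ℝ≥0∞) 1 := m.2.resolve_right hmt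
    obtain ⟨r, hr0, hr⟩ : ∃ r : ℝ, 0 ≤ r ∧ (m : ℝ≥0∞) = ENNReal.ofReal r :=
      ⟨(m : ℝ≥0∞).toReal, ENNReal.toReal_nonneg, (ENNReal.ofReal_toReal hmt).symm⟩
    have h2 := half_eq_ofReal
    have hr2 : 1 / 2 ≤ r := by
      have := h2.symm.le.trans (hmI.1.trans hr.le)
      exact (ENNReal.ofReal_le_ofReal_iff hr0).1 this
    have hrx : r ≤ x := by
      rw [hr, not_lt] at hm
      exact (ENNReal.ofReal_le_ofReal_iff hx0.le).1 hm
    have hr1 : r ≤ 1 := hrx.trans hx.2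
    have h1 : (fun u => exceed x (Φ m u))
        = (Set.Ici (⟨r, hr0, hr1⟩ : unitInterval)).indicator 1 := by
      ext u
      by_cases hu : r ≤ (u : ℝ)
      · have h3 : ¬ ENNReal.ofReal (u : ℝ) < (m : ℝ≥0∞) := by
          rw [hr, not_lt]; exact ENNReal.ofReal_le_ofReal hu
        have h4 : Φ m u = I.infty := if_neg h3
        rw [h4, exceed_eq_one (show ENNReal.ofReal x < (I.infty : ℝ≥0∞) from ENNReal.ofReal_lt_top),
          Set.indicator_of_mem (show u ∈ Set.Ici (⟨r, hr0, hr1⟩ : unitInterval) from hu),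
          Pi.one_apply]
      · have h3 : ENNReal.ofReal (u : ℝ) < (m : ℝ≥0∞) := by
          rw [hr]; exact (ENNReal.ofReal_lt_ofReal_iff (by linarith)).2 (not_le.1 hu)
        have h4 : Φ m u = m := if_pos h3
        rw [h4, exceed_eq_zero hm,
          Set.indicator_of_notMem (show u ∉ Set.Ici (⟨r, hr0, hr1⟩ : unitInterval) from hu)]
    have h3 : (fun s => exceed s m) = (Set.Iio r).indicator 1 := by
      ext s
      simp only [exceed, Set.indicator, Set.mem_ofPred_eq, Set.mem_Iio, hr,
        ENNReal.ofReal_lt_ofReal_iff (show 0 < r by linarith), Pi.one_apply]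
    have h4 : exceed x m = 0 := exceed_eq_zero hm
    have h5 : Set.Iio r ∩ Set.Ioc (1 / 2) x = Set.Ioo (1 / 2) r := by
      ext s; simp only [Set.mem_inter_iff, Set.mem_Iio, Set.mem_Ioc, Set.mem_Ioo]
      constructor
      · rintro ⟨h, h', -⟩; exact ⟨h', h⟩
      · rintro ⟨h, h'⟩; exact ⟨h', h, by linarith⟩
    rw [h1, integral_indicator_one measurableSet_Ici, step, h4, h3,
      integral_indicator_one measurableSet_Iio, measureReal_restrict_apply measurableSet_Iio, h5]
    simp only [measureReal_def, unitInterval.volume_Ici, Real.volume_Ioo]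
    rw [ENNReal.toReal_ofReal (by simpa using hr1), ENNReal.toReal_ofReal (by linarith)]
    simp; ring

lemma step_antitoneOn {r : ℝ → ℝ} (hr : AntitoneOn r (Set.Icc (1 / 2) 1)) :
    AntitoneOn (step r) (Set.Icc (1 / 2) 1) := by
  intro x hx y hy hxy
  have hint : ∀ a b, a ∈ Set.Icc (1 / 2 : ℝ) 1 → b ∈ Set.Icc (1 / 2 : ℝ) 1 → a ≤ b →
      IntervalIntegrable r volume a b := fun a b ha hb hab =>
    AntitoneOn.intervalIntegrable (by
      rw [Set.uIcc_of_le hab]; exact hr.mono (Set.Icc_subset_Icc ha.1 hb.2))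
  have h0 : (1 / 2 : ℝ) ∈ Set.Icc (1 / 2 : ℝ) 1 := by norm_num
  have h1 : (y - x) * r y ≤ ∫ s in x..y, r s := by
    have := intervalIntegral.integral_mono_on hxy
      (intervalIntegrable_const (c := r y)) (hint x y hx hy hxy)
      (fun s hs => hr ⟨hx.1.trans hs.1, hs.2.trans hy.2⟩ hy hs.2)
    simpa using this
  have h2 := intervalIntegral.integral_add_adjacent_intervals (hint _ _ h0 hx hx.1)
    (hint _ _ hx hy hxy)
  have h3 := mul_nonneg (by linarith [hx.1] : 0 ≤ x) (sub_nonneg.2 (hr hx hy hxy))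
  simp only [step, ← intervalIntegral.integral_of_le hx.1, ← intervalIntegral.integral_of_le hy.1]
  rw [← h2]
  linarith

lemma step_mem_Icc {r : ℝ → ℝ} (hr : AntitoneOn r (Set.Icc (1 / 2) 1))
    (hr01 : ∀ x ∈ Set.Icc (1 / 2 : ℝ) 1, r x ∈ Set.Icc (0 : ℝ) 1) {x : ℝ}
    (hx : x ∈ Set.Icc (1 / 2 : ℝ) 1) : step r x ∈ Set.Icc (0 : ℝ) 1 := by
  have h0 : (1 / 2 : ℝ) ∈ Set.Icc (1 / 2 : ℝ) 1 := by norm_num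
  have h1 : (1 : ℝ) ∈ Set.Icc (1 / 2 : ℝ) 1 := by norm_num
  constructor
  · refine le_trans ?_ (step_antitoneOn hr hx h1 hx.2)
    have h12 : (1 / 2 : ℝ) ≤ 1 := by norm_num
    have : ∫ s in (1 / 2 : ℝ)..1, r s ≤ ∫ s in (1 / 2 : ℝ)..1, (1 : ℝ) :=
      intervalIntegral.integral_mono_on h12
        (AntitoneOn.intervalIntegrable (by rwa [Set.uIcc_of_le h12])) intervalIntegrable_const
        (fun s hs => (hr01 s hs).2)
    rw [intervalIntegral.integral_of_le h12] at this
    have h3 := (hr01 1 h1).1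
    simp only [intervalIntegral.integral_const, smul_eq_mul] at this
    simp only [step]
    linarith
  · refine (step_antitoneOn hr h0 hx hx.1).trans ?_
    have := (hr01 _ h0).2
    simp only [step, Set.Ioc_self, Measure.restrict_empty, integral_zero_measure]
    linarith

/-- `ν` solves the frozen percolation equation: its survival function `1 / (2 x)` is fixed. -/
lemma step_survival {x : ℝ} (hx : x ∈ Set.Icc (1 / 2 : ℝ) 1) :
    step (fun s => (1 / (2 * s)) ^ 2) x = 1 / (2 * x) := by
  have hx0 : 0 < x := by linarith [hx.1]
  have hne : ∀ t ∈ Set.uIcc (1 / 2) x, t ≠ 0 := by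
    intro t ht
    rw [Set.uIcc_of_le hx.1] at ht
    linarith [ht.1]
  have hder : ∀ t ∈ Set.uIcc (1 / 2) x,
      HasDerivAt (fun t : ℝ => - (1 / (4 * t))) ((1 / (2 * t)) ^ 2) t := by
    intro t ht
    have := ((hasDerivAt_inv (hne t ht)).const_mul (1 / 4 : ℝ)).neg
    refine (this.congr_of_eventuallyEq (.of_forall fun s => ?_)).congr_deriv ?_
    · simp [mul_comm]
    · have := hne t ht
      field_simp; norm_num
  have hcont : ContinuousOn (fun t : ℝ => (1 / (2 * t)) ^ 2) (Set.uIcc (1 / 2) x) := by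
    intro t ht
    have := hne t ht
    exact ContinuousAt.continuousWithinAt (by fun_prop (disch := positivity))
  rw [step, ← intervalIntegral.integral_of_le hx.1,
    intervalIntegral.integral_eq_sub_of_hasDerivAt hder hcont.intervalIntegrable]
  field_simp
  norm_num
  ring

/-! ### Independence and null sets -/

section Independence

variable {Ω : Type*} {mΩ : MeasurableSpace Ω} {P : Measure Ω}

/-- If `H` is independent of `M`, and `N` of `H` and `M` together, then `H` is independent of `M`
and `N` together. -/
lemma indep_sup_of_indep [IsProbabilityMeasure P] {H M N : MeasurableSpace Ω}
    (hH : H ≤ mΩ) (hM : M ≤ mΩ) (hN : N ≤ mΩ)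
    (h : Indep H M P) (h' : Indep N (H ⊔ M) P) : Indep H (M ⊔ N) P := by
  have hgen : M ⊔ N = MeasurableSpace.generateFrom
      (Set.image2 (· ∩ ·) {s | MeasurableSet[M] s} {s | MeasurableSet[N] s}) := by
    apply le_antisymm
    · refine sup_le (fun s hs => ?_) (fun s hs => ?_)
      · exact MeasurableSpace.measurableSet_generateFrom
          ⟨s, hs, Set.univ, MeasurableSet.univ, Set.inter_univ s⟩
      · exact MeasurableSpace.measurableSet_generateFrom
          ⟨Set.univ, MeasurableSet.univ, s, hs, Set.univ_inter s⟩
    · apply MeasurableSpace.generateFrom_le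
      rintro _ ⟨s, hs, t, ht, rfl⟩
      exact MeasurableSet.inter ((le_sup_left : M ≤ M ⊔ N) s hs) ((le_sup_right : N ≤ M ⊔ N) t ht)
  have hpi : IsPiSystem
      (Set.image2 (· ∩ ·) {s | MeasurableSet[M] s} {s | MeasurableSet[N] s}) := by
    rintro _ ⟨s, hs, t, ht, rfl⟩ _ ⟨s', hs', t', ht', rfl⟩ -
    exact ⟨s ∩ s', MeasurableSet.inter hs hs', t ∩ t', MeasurableSet.inter ht ht',
      Set.inter_inter_inter_comm s s' t t'⟩
  refine IndepSets.indep hH (sup_le hM hN) (@MeasurableSpace.isPiSystem_measurableSet Ω H) hpi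
    (@MeasurableSpace.generateFrom_measurableSet Ω H).symm hgen ?_
  rw [IndepSets_iff]
  rintro A _ hA ⟨B, hB, C, hC, rfl⟩
  rw [Indep_iff] at h h'
  have hA' : MeasurableSet[H ⊔ M] A := (le_sup_left : H ≤ H ⊔ M) A hA
  have hB' : MeasurableSet[H ⊔ M] B := (le_sup_right : M ≤ H ⊔ M) B hB
  have h1 := h' C (A ∩ B) hC (MeasurableSet.inter hA' hB')
  have h2 := h' C B hC hB'
  have h3 := h A B hA hB
  calc P (A ∩ (B ∩ C)) = P (C ∩ (A ∩ B)) := by congr 1; ext; simp; tauto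
    _ = P A * P (C ∩ B) := by rw [h1, h2, h3]; ring
    _ = P A * P (B ∩ C) := by rw [Set.inter_comm]

/-- The events that agree with an event of `m` up to a null set. -/
@[reducible] def aeClosure (P : Measure Ω) (m : MeasurableSpace Ω) : MeasurableSpace Ω :=
  eventuallyMeasurableSpace m (ae P) ⊓ mΩ

lemma measurableSet_aeClosure {m : MeasurableSpace Ω} {s : Set Ω} :
    MeasurableSet[aeClosure P m] s ↔
      (∃ t, MeasurableSet[m] t ∧ s =ᵐ[P] t) ∧ MeasurableSet[mΩ] s :=
  MeasurableSpace.measurableSet_inf (m₁ := eventuallyMeasurableSpace m (ae P)) (m₂ := mΩ)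

lemma aeClosure_le (m : MeasurableSpace Ω) : aeClosure P m ≤ mΩ := inf_le_right

lemma le_aeClosure {m : MeasurableSpace Ω} (hm : m ≤ mΩ) : m ≤ aeClosure P m :=
  le_inf le_eventuallyMeasurableSpace hm

lemma measurable_aeClosure_of_ae_eq {β : Type*} [MeasurableSpace β] {m : MeasurableSpace Ω}
    {f g : Ω → β} (hf : Measurable[mΩ] f) (hg : Measurable[aeClosure P m] g) (h : f =ᵐ[P] g) :
    Measurable[aeClosure P m] f := by
  intro s hs
  rw [measurableSet_aeClosure]
  have h1 : Measurable[eventuallyMeasurableSpace m (ae P)] g := hg.mono inf_le_left le_rfl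
  exact ⟨EventuallyMeasurable.congr (m := m) (l := ae P) h1 h hs, hf hs⟩

lemma aeClosure_mono {m m' : MeasurableSpace Ω} (h : m ≤ aeClosure P m') :
    aeClosure P m ≤ aeClosure P m' := by
  intro s hs
  rw [measurableSet_aeClosure] at hs ⊢
  obtain ⟨⟨t, ht, hst⟩, hs⟩ := hs
  have h' : m ≤ eventuallyMeasurableSpace m' (ae P) := h.trans inf_le_left
  exact ⟨EventuallyMeasurableSet.congr (m := m') (l := ae P) (h' t ht) hst, hs⟩

lemma indep_aeClosure_right {m m' : MeasurableSpace Ω} (h : Indep m m' P) :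
    Indep m (aeClosure P m') P := by
  rw [Indep_iff] at h ⊢
  intro s t hs ht
  rw [measurableSet_aeClosure] at ht
  obtain ⟨⟨t', ht', htt'⟩, -⟩ := ht
  rw [measure_congr htt', ← h s t' hs ht']
  exact measure_congr (Filter.EventuallyEq.rfl.inter htt')

end Independence

/-! ### Contraction of the variance -/

section Variance

variable {Ω : Type*} [MeasurableSpace Ω] {P : Measure Ω} [IsProbabilityMeasure P]

/-- Fubini's theorem for `step`. -/
lemma integral_step_mul {r : Ω → ℝ → ℝ} (hr : Measurable (Function.uncurry r))
    (hr01 : ∀ ω, ∀ x ∈ Set.Icc (1 / 2 : ℝ) 1, r ω x ∈ Set.Icc (0 : ℝ) 1)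
    {Z : Ω → ℝ} (hZ : Measurable Z) {C : ℝ} (hC : ∀ ω, |Z ω| ≤ C)
    {x : ℝ} (hx : x ∈ Set.Icc (1 / 2 : ℝ) 1) :
    ∫ ω, step (r ω) x * Z ω ∂P
      = 1 / 2 * ∫ ω, Z ω ∂P + x * ∫ ω, r ω x * Z ω ∂P
        - ∫ s in Set.Ioc (1 / 2) x, ∫ ω, r ω s * Z ω ∂P := by
  have hsub : ∀ s ∈ Set.Ioc (1 / 2) x, s ∈ Set.Icc (1 / 2 : ℝ) 1 :=
    fun s hs => ⟨hs.1.le, hs.2.trans hx.2⟩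
  have hbd : ∀ ω, ∀ s ∈ Set.Icc (1 / 2 : ℝ) 1, |r ω s * Z ω| ≤ C := fun ω s hs => by
    rw [abs_mul, abs_of_nonneg (hr01 ω s hs).1]
    nlinarith [(hr01 ω s hs).1, (hr01 ω s hs).2, hC ω, abs_nonneg (Z ω)]
  have hZi : Integrable Z P := Integrable.of_bound hZ.aestronglyMeasurable C
    (.of_forall fun ω => by simpa using hC ω)
  have hrx : Measurable (fun ω => r ω x) := hr.comp (by fun_prop : Measurable fun ω => (ω, x))
  have hri : Integrable (fun ω => r ω x * Z ω) P := Integrable.of_bound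
    (hrx.mul hZ).aestronglyMeasurable C (.of_forall fun ω => by simpa using hbd ω x hx)
  have hprod : Integrable (Function.uncurry fun ω s => r ω s * Z ω)
      (P.prod (volume.restrict (Set.Ioc (1 / 2) x))) := by
    refine Integrable.of_bound
      (hr.mul (hZ.comp measurable_fst)).aestronglyMeasurable C ?_
    have hms : MeasurableSet {p : Ω × ℝ | ‖Function.uncurry (fun ω s => r ω s * Z ω) p‖ ≤ C} :=
      measurableSet_le (hr.mul (hZ.comp measurable_fst)).norm measurable_const
    rw [Measure.ae_prod_iff_ae_ae hms]
    filter_upwards with ω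
    filter_upwards [ae_restrict_mem measurableSet_Ioc] with s hs
    simpa using hbd ω s (hsub s hs)
  have hswap := integral_integral_swap hprod
  have hii := hprod.integral_prod_left
  simp only [Function.uncurry] at hii
  calc ∫ ω, step (r ω) x * Z ω ∂P
      = ∫ ω, (1 / 2 * Z ω + x * (r ω x * Z ω)
          - ∫ s in Set.Ioc (1 / 2) x, r ω s * Z ω) ∂P := by
        congr 1; ext ω
        rw [integral_mul_const, step]; ring
    _ = _ := by
        rw [integral_sub ((hZi.const_mul _).fun_add (hri.const_mul _)) hii,
          integral_add (hZi.const_mul _) (hri.const_mul _), integral_const_mul,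
          integral_const_mul, hswap]

lemma integral_sub_mul_add_const {α : Type*} [MeasurableSpace α] {μ : Measure α} [IsFiniteMeasure μ]
    {f g : α → ℝ} (hf : Integrable f μ) (hg : Integrable g μ) (b c : ℝ) :
    ∫ a, (f a - b * g a + c) ∂μ = (∫ a, f a ∂μ) - b * (∫ a, g a ∂μ) + μ.real Set.univ * c := by
  have h : Integrable (fun a => f a - b * g a) μ := hf.sub (hg.const_mul b)
  rw [integral_add h (integrable_const _), integral_sub hf (hg.const_mul _), integral_const_mul,
    integral_const, smul_eq_mul]

/-- Jensen's inequality on an interval of length at most `1 / 2`. -/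
lemma sq_setIntegral_le {w : ℝ → ℝ} {x : ℝ} (hx : x ∈ Set.Icc (1 / 2 : ℝ) 1)
    (hw : IntegrableOn w (Set.Ioc (1 / 2) x))
    (hw2 : IntegrableOn (fun s => w s ^ 2) (Set.Ioc (1 / 2) x)) :
    (∫ s in Set.Ioc (1 / 2) x, w s) ^ 2 ≤ 1 / 2 * ∫ s in Set.Ioc (1 / 2) x, w s ^ 2 := by
  set t := ∫ s in Set.Ioc (1 / 2) x, w s with ht
  have h0 : 0 ≤ ∫ s in Set.Ioc (1 / 2) x, (w s - 2 * t) ^ 2 :=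
    integral_nonneg fun s => sq_nonneg _
  have h1 : ∫ s in Set.Ioc (1 / 2) x, (w s - 2 * t) ^ 2
      = (∫ s in Set.Ioc (1 / 2) x, w s ^ 2) - 4 * t * t + (x - 1 / 2) * (4 * t ^ 2) := by
    have : ∀ s, (w s - 2 * t) ^ 2 = w s ^ 2 - 4 * t * w s + 4 * t ^ 2 := fun s => by ring
    simp only [this]
    rw [integral_sub_mul_add_const hw2 hw, ← ht]
    simp only [measureReal_def, Measure.restrict_apply_univ, Real.volume_Ioc]
    rw [ENNReal.toReal_ofReal (by linarith [hx.1])]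
  nlinarith [hx.2, sq_nonneg t]

/-- A random variable with values in `[0, 1]` and mean `m ≥ 1 / 2` has variance at most `m ^ 2`. -/
lemma integral_sq_sub_le {p : Ω → ℝ} (hp : Measurable p) (hp01 : ∀ ω, p ω ∈ Set.Icc (0 : ℝ) 1)
    {m : ℝ} (hm : 1 / 2 ≤ m) (hpm : ∫ ω, p ω ∂P = m) :
    ∫ ω, p ω ^ 2 ∂P = ∫ ω, (p ω - m) ^ 2 ∂P + m ^ 2 ∧ ∫ ω, (p ω - m) ^ 2 ∂P ≤ m ^ 2 := by
  have hpi : Integrable p P := Integrable.of_bound hp.aestronglyMeasurable 1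
    (.of_forall fun ω => by rw [Real.norm_eq_abs, abs_of_nonneg (hp01 ω).1]; exact (hp01 ω).2)
  have hpi2 : Integrable (fun ω => p ω ^ 2) P := Integrable.of_bound
    (hp.pow_const 2).aestronglyMeasurable 1
    (.of_forall fun ω => by
      rw [Real.norm_eq_abs, abs_of_nonneg (sq_nonneg _)]
      exact pow_le_one₀ (hp01 ω).1 (hp01 ω).2)
  have h1 : ∫ ω, (p ω - m) ^ 2 ∂P = (∫ ω, p ω ^ 2 ∂P) - m ^ 2 := by
    have : ∀ ω, (p ω - m) ^ 2 = p ω ^ 2 - 2 * m * p ω + m ^ 2 := fun s => by ring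
    simp only [this]
    rw [integral_sub_mul_add_const hpi2 hpi, hpm, probReal_univ]
    ring
  have h2 : ∫ ω, p ω ^ 2 ∂P ≤ m := by
    rw [← hpm]
    refine integral_mono hpi2 hpi fun ω => ?_
    have := hp01 ω
    simp only
    nlinarith [this.1, this.2]
  constructor
  · linarith
  · nlinarith

/-- Since both factors have mean `m ≥ 1 / 2`, their variances are at most `m ^ 2`, which absorbs the
quadratic term in the variance of the product. -/
lemma integral_sq_mul_sub_le {p q : Ω → ℝ} (hp : Measurable p) (hq : Measurable q)
    (hp01 : ∀ ω, p ω ∈ Set.Icc (0 : ℝ) 1) (hq01 : ∀ ω, q ω ∈ Set.Icc (0 : ℝ) 1)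
    (hpq : IndepFun p q P) {m : ℝ} (hm : 1 / 2 ≤ m) (hpm : ∫ ω, p ω ∂P = m)
    (hqm : ∫ ω, q ω ∂P = m) {B : ℝ} (hpB : ∫ ω, (p ω - m) ^ 2 ∂P ≤ B)
    (hqB : ∫ ω, (q ω - m) ^ 2 ∂P ≤ B) :
    ∫ ω, p ω * q ω ∂P = m ^ 2 ∧ ∫ ω, (p ω * q ω - m ^ 2) ^ 2 ∂P ≤ 3 * m ^ 2 * B := by
  have h1 : ∫ ω, p ω * q ω ∂P = m ^ 2 := by
    have := hpq.integral_mul_eq_mul_integral hp.aestronglyMeasurable hq.aestronglyMeasurable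
    rw [hpm, hqm] at this
    rw [sq, ← this]; rfl
  refine ⟨h1, ?_⟩
  have h2 : ∫ ω, p ω ^ 2 * q ω ^ 2 ∂P = (∫ ω, p ω ^ 2 ∂P) * ∫ ω, q ω ^ 2 ∂P :=
    (hpq.comp (measurable_id.pow_const 2) (measurable_id.pow_const 2)).integral_mul_eq_mul_integral
      (hp.pow_const 2).aestronglyMeasurable (hq.pow_const 2).aestronglyMeasurable
  obtain ⟨h3, h4⟩ := integral_sq_sub_le hp hp01 hm hpm
  obtain ⟨h5, h6⟩ := integral_sq_sub_le hq hq01 hm hqm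
  have hpq01 : ∀ ω, p ω * q ω ∈ Set.Icc (0 : ℝ) 1 := fun ω =>
    ⟨mul_nonneg (hp01 ω).1 (hq01 ω).1, mul_le_one₀ (hp01 ω).2 (hq01 ω).1 (hq01 ω).2⟩
  have hi : Integrable (fun ω => p ω * q ω) P := Integrable.of_bound
    (hp.mul hq).aestronglyMeasurable 1 (.of_forall fun ω => by
      rw [Real.norm_eq_abs, abs_of_nonneg (hpq01 ω).1]; exact (hpq01 ω).2)
  have hi2 : Integrable (fun ω => p ω ^ 2 * q ω ^ 2) P := Integrable.of_bound
    ((hp.pow_const 2).mul (hq.pow_const 2)).aestronglyMeasurable 1 (.of_forall fun ω => by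
      rw [← mul_pow, Real.norm_eq_abs, abs_of_nonneg (sq_nonneg _)]
      exact pow_le_one₀ (hpq01 ω).1 (hpq01 ω).2)
  have h7 : ∫ ω, (p ω * q ω - m ^ 2) ^ 2 ∂P = (∫ ω, p ω ^ 2 * q ω ^ 2 ∂P) - m ^ 4 := by
    have : ∀ ω, (p ω * q ω - m ^ 2) ^ 2
        = p ω ^ 2 * q ω ^ 2 - 2 * m ^ 2 * (p ω * q ω) + m ^ 4 := fun s => by ring
    simp only [this]
    rw [integral_sub_mul_add_const hi2 hi, h1, probReal_univ]
    ring
  have h8 : 0 ≤ ∫ ω, (p ω - m) ^ 2 ∂P := integral_nonneg fun _ => sq_nonneg _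
  have h9 : 0 ≤ ∫ ω, (q ω - m) ^ 2 ∂P := integral_nonneg fun _ => sq_nonneg _
  rw [h7, h2, h3, h5]
  set v := ∫ ω, (p ω - m) ^ 2 ∂P
  set v' := ∫ ω, (q ω - m) ^ 2 ∂P
  nlinarith [mul_le_mul h4 hqB h9 (sq_nonneg m), sq_nonneg m]

/-- The contraction estimate: one step of the recursion multiplies the variance of the conditional
survival functions, weighted by `exp (-150 x)`, by at most `14 / 15`. -/
lemma step_contraction {p q : Ω → ℝ → ℝ} (hp : Measurable (Function.uncurry p))
    (hq : Measurable (Function.uncurry q))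
    (hp01 : ∀ ω, ∀ x ∈ Set.Icc (1 / 2 : ℝ) 1, p ω x ∈ Set.Icc (0 : ℝ) 1)
    (hq01 : ∀ ω, ∀ x ∈ Set.Icc (1 / 2 : ℝ) 1, q ω x ∈ Set.Icc (0 : ℝ) 1)
    (hpq : ∀ x, IndepFun (fun ω => p ω x) (fun ω => q ω x) P)
    (hpm : ∀ x ∈ Set.Icc (1 / 2 : ℝ) 1, ∫ ω, p ω x ∂P = 1 / (2 * x))
    (hqm : ∀ x ∈ Set.Icc (1 / 2 : ℝ) 1, ∫ ω, q ω x ∂P = 1 / (2 * x)) {B : ℝ}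
    (hpB : ∀ x ∈ Set.Icc (1 / 2 : ℝ) 1,
      ∫ ω, (p ω x - 1 / (2 * x)) ^ 2 ∂P ≤ B * Real.exp (150 * x))
    (hqB : ∀ x ∈ Set.Icc (1 / 2 : ℝ) 1,
      ∫ ω, (q ω x - 1 / (2 * x)) ^ 2 ∂P ≤ B * Real.exp (150 * x))
    {x : ℝ} (hx : x ∈ Set.Icc (1 / 2 : ℝ) 1) :
    ∫ ω, step (fun s => p ω s * q ω s) x ∂P = 1 / (2 * x) ∧
    ∫ ω, (step (fun s => p ω s * q ω s) x - 1 / (2 * x)) ^ 2 ∂P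
      ≤ 14 / 15 * B * Real.exp (150 * x) := by
  have hx0 : 0 < x := by linarith [hx.1]
  have hsub : ∀ s ∈ Set.Ioc (1 / 2) x, s ∈ Set.Icc (1 / 2 : ℝ) 1 :=
    fun s hs => ⟨hs.1.le, hs.2.trans hx.2⟩
  have hpx : ∀ x, Measurable (fun ω => p ω x) := fun x =>
    hp.comp (by fun_prop : Measurable fun ω => (ω, x))
  have hqx : ∀ x, Measurable (fun ω => q ω x) := fun x =>
    hq.comp (by fun_prop : Measurable fun ω => (ω, x))
  have hm : ∀ x ∈ Set.Icc (1 / 2 : ℝ) 1, 1 / 2 ≤ 1 / (2 * x) := fun x hx =>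
    one_div_le_one_div_of_le (by linarith [hx.1]) (by linarith [hx.2])
  have hkey := fun x hx => integral_sq_mul_sub_le (hpx x) (hqx x) (fun ω => hp01 ω x hx)
    (fun ω => hq01 ω x hx) (hpq x) (hm x hx) (hpm x hx) (hqm x hx) (hpB x hx) (hqB x hx)
  have hpq01 : ∀ ω, ∀ x ∈ Set.Icc (1 / 2 : ℝ) 1, p ω x * q ω x ∈ Set.Icc (0 : ℝ) 1 :=
    fun ω x hx => ⟨mul_nonneg (hp01 ω x hx).1 (hq01 ω x hx).1,
      mul_le_one₀ (hp01 ω x hx).2 (hq01 ω x hx).1 (hq01 ω x hx).2⟩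
  have hpqm : Measurable (Function.uncurry fun ω s => p ω s * q ω s) := hp.mul hq
  constructor
  · have := integral_step_mul (P := P) hpqm hpq01 (Z := fun _ => 1) measurable_const (C := 1)
      (fun _ => by simp) hx
    simp only [mul_one, integral_const, probReal_univ, smul_eq_mul] at this
    rw [this, (hkey x hx).1, setIntegral_congr_fun measurableSet_Ioc
      (fun s hs => (hkey s (hsub s hs)).1)]
    exact step_survival hx
  -- The deviation `w` of the product from its mean.
  set w : Ω → ℝ → ℝ := fun ω s => p ω s * q ω s - (1 / (2 * s)) ^ 2 with hw
  have hwm : Measurable (Function.uncurry w) := hpqm.sub (by fun_prop)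
  have ham : ∀ s ∈ Set.Icc (1 / 2 : ℝ) 1, (1 / (2 * s)) ^ 2 ∈ Set.Icc (0 : ℝ) 1 := fun s hs => by
    have h1 : 1 / (2 * s) ≤ 1 := by
      rw [div_le_one (by linarith [hs.1])]; linarith [hs.1]
    have h0 : 0 ≤ 1 / (2 * s) := by linarith [hm s hs]
    exact ⟨sq_nonneg _, pow_le_one₀ h0 h1⟩
  have hw1 : ∀ ω, ∀ s ∈ Set.Icc (1 / 2 : ℝ) 1, |w ω s| ≤ 1 := fun ω s hs => by
    rw [abs_le]
    have h1 := hpq01 ω s hs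
    have h2 := ham s hs
    constructor <;> simp only [hw] <;> linarith [h1.1, h1.2, h2.1, h2.2]
  have hw2 : ∀ ω, ∀ s ∈ Set.Icc (1 / 2 : ℝ) 1, w ω s ^ 2 ≤ 1 := fun ω s hs => by
    rw [← sq_abs]; exact pow_le_one₀ (abs_nonneg _) (hw1 ω s hs)
  have hwω : ∀ ω, Measurable (w ω) := fun ω => hwm.comp (by fun_prop : Measurable fun s => (ω, s))
  have hwx : ∀ s, Measurable (fun ω => w ω s) := fun s =>
    hwm.comp (by fun_prop : Measurable fun ω => (ω, s))
  have hwi : ∀ ω, IntegrableOn (w ω) (Set.Ioc (1 / 2) x) := fun ω =>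
    Integrable.of_bound (hwω ω).aestronglyMeasurable 1 (by
      filter_upwards [ae_restrict_mem measurableSet_Ioc] with s hs
      simpa using hw1 ω s (hsub s hs))
  have hwi2 : ∀ ω, IntegrableOn (fun s => w ω s ^ 2) (Set.Ioc (1 / 2) x) := fun ω =>
    Integrable.of_bound ((hwω ω).pow_const 2).aestronglyMeasurable 1 (by
      filter_upwards [ae_restrict_mem measurableSet_Ioc] with s hs
      rw [Real.norm_eq_abs, abs_of_nonneg (sq_nonneg _)]
      exact hw2 ω s (hsub s hs))
  have hai : IntegrableOn (fun s : ℝ => (1 / (2 * s)) ^ 2) (Set.Ioc (1 / 2) x) :=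
    Integrable.of_bound (Measurable.aestronglyMeasurable (by fun_prop)) 1 (by
      filter_upwards [ae_restrict_mem measurableSet_Ioc] with s hs
      have := ham s (hsub s hs)
      rw [Real.norm_eq_abs, abs_of_nonneg this.1]
      exact this.2)
  have hdev : ∀ ω, step (fun s => p ω s * q ω s) x - 1 / (2 * x)
      = x * w ω x - ∫ s in Set.Ioc (1 / 2) x, w ω s := fun ω => by
    have hpqi : IntegrableOn (fun s => p ω s * q ω s) (Set.Ioc (1 / 2) x) := by
      have := (hwi ω).add hai
      refine this.congr (.of_forall fun s => ?_)
      simp [hw]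
    rw [← step_survival hx, hw, integral_sub hpqi hai]
    simp only [step]
    ring
  have hpt : ∀ ω, (step (fun s => p ω s * q ω s) x - 1 / (2 * x)) ^ 2
      ≤ 10 / 9 * x ^ 2 * w ω x ^ 2 + 5 * ∫ s in Set.Ioc (1 / 2) x, w ω s ^ 2 := fun ω => by
    rw [hdev]
    have h1 := sq_setIntegral_le hx (hwi ω) (hwi2 ω)
    set t := ∫ s in Set.Ioc (1 / 2) x, w ω s
    -- Young's inequality `(a - t)² ≤ (1 + 1/9) a² + (1 + 9) t²`
    nlinarith [sq_nonneg (x * w ω x + 9 * t)]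
  have hprod : Integrable (Function.uncurry fun ω s => w ω s ^ 2)
      (P.prod (volume.restrict (Set.Ioc (1 / 2) x))) := by
    refine Integrable.of_bound (hwm.pow_const 2).aestronglyMeasurable 1 ?_
    have hms : MeasurableSet {p : Ω × ℝ | ‖Function.uncurry (fun ω s => w ω s ^ 2) p‖ ≤ 1} :=
      measurableSet_le (hwm.pow_const 2).norm measurable_const
    rw [Measure.ae_prod_iff_ae_ae hms]
    filter_upwards with ω
    filter_upwards [ae_restrict_mem measurableSet_Ioc] with s hs
    simp only [Function.uncurry_apply_pair]
    rw [Real.norm_eq_abs, abs_of_nonneg (sq_nonneg _)]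
    exact hw2 ω s (hsub s hs)
  have hi1 : Integrable (fun ω => w ω x ^ 2) P := Integrable.of_bound
    ((hwx x).pow_const 2).aestronglyMeasurable 1 (.of_forall fun ω => by
      rw [Real.norm_eq_abs, abs_of_nonneg (sq_nonneg _)]
      exact hw2 ω x hx)
  have hi2 := hprod.integral_prod_left
  simp only [Function.uncurry] at hi2
  have hE : ∀ s ∈ Set.Icc (1 / 2 : ℝ) 1,
      ∫ ω, w ω s ^ 2 ∂P ≤ 3 / (4 * s ^ 2) * (B * Real.exp (150 * s)) := fun s hs => by
    refine (hkey s hs).2.trans_eq ?_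
    have : 0 < s := by linarith [hs.1]
    field_simp; ring
  have hB0 : 0 ≤ B := by
    have h1 := (integral_nonneg (μ := P) fun ω => sq_nonneg (p ω x - 1 / (2 * x))).trans (hpB x hx)
    exact nonneg_of_mul_nonneg_left h1 (Real.exp_pos _)
  have hE' : ∀ s ∈ Set.Icc (1 / 2 : ℝ) 1,
      ∫ ω, w ω s ^ 2 ∂P ≤ 3 * (B * Real.exp (150 * s)) := fun s hs => by
    refine (hE s hs).trans (mul_le_mul_of_nonneg_right ?_ (by positivity))
    have : 0 < s := by linarith [hs.1]
    rw [div_le_iff₀ (by positivity)]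
    nlinarith [hs.1]
  have hexp : ∫ s in Set.Ioc (1 / 2) x, 3 * (B * Real.exp (150 * s))
      ≤ 1 / 50 * (B * Real.exp (150 * x)) := by
    rw [integral_const_mul, integral_const_mul, ← intervalIntegral.integral_of_le hx.1,
      intervalIntegral.integral_comp_mul_left (fun s => Real.exp s) (by norm_num), integral_exp]
    have := Real.exp_pos (150 * (1 / 2))
    have := mul_nonneg hB0 this.le
    simp only [smul_eq_mul]
    linarith
  have h5 : ∫ s in Set.Ioc (1 / 2) x, ∫ ω, w ω s ^ 2 ∂P
      ≤ ∫ s in Set.Ioc (1 / 2) x, 3 * (B * Real.exp (150 * s)) :=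
    setIntegral_mono_on hprod.integral_prod_right
      (Continuous.integrableOn_Ioc (by fun_prop)) measurableSet_Ioc
      (fun s hs => hE' s (hsub s hs))
  calc ∫ ω, (step (fun s => p ω s * q ω s) x - 1 / (2 * x)) ^ 2 ∂P
      ≤ ∫ ω, (10 / 9 * x ^ 2 * w ω x ^ 2 + 5 * ∫ s in Set.Ioc (1 / 2) x, w ω s ^ 2) ∂P :=
        integral_mono_of_nonneg (.of_forall fun ω => sq_nonneg _)
          ((hi1.const_mul _).add (hi2.const_mul _)) (.of_forall hpt)
    _ = 10 / 9 * x ^ 2 * ∫ ω, w ω x ^ 2 ∂P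
        + 5 * ∫ s in Set.Ioc (1 / 2) x, ∫ ω, w ω s ^ 2 ∂P := by
        rw [integral_add (hi1.const_mul _) (hi2.const_mul _), integral_const_mul,
          integral_const_mul, integral_integral_swap hprod]
    _ ≤ 10 / 9 * x ^ 2 * (3 / (4 * x ^ 2) * (B * Real.exp (150 * x)))
        + 5 * (1 / 50 * (B * Real.exp (150 * x))) := by
        gcongr
        · exact hE x hx
        · exact h5.trans hexp
    _ = 14 / 15 * B * Real.exp (150 * x) := by
        field_simp; ring

end Variance

/-! ### Frozen percolation on a binary forest -/

/-- The σ-algebra generated by the variables `X j` with `j ∈ S`. -/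
@[reducible] def sigmaOn {Ω J β : Type*} [MeasurableSpace β] (X : J → Ω → β) (S : Set J) :
    MeasurableSpace Ω :=
  ⨆ j ∈ S, MeasurableSpace.comap (X j) inferInstance

section SigmaOn

variable {Ω J β : Type*} [MeasurableSpace β] {X : J → Ω → β}

lemma sigmaOn_le_iff {m : MeasurableSpace Ω} {S : Set J} :
    sigmaOn X S ≤ m ↔ ∀ j ∈ S, Measurable[m] (X j) := by
  simp only [sigmaOn, iSup_le_iff, measurable_iff_comap_le]

lemma measurable_sigmaOn {S : Set J} {j : J} (hj : j ∈ S) : Measurable[sigmaOn X S] (X j) :=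
  sigmaOn_le_iff.1 le_rfl j hj

lemma sigmaOn_mono {S T : Set J} (h : S ⊆ T) : sigmaOn X S ≤ sigmaOn X T :=
  sigmaOn_le_iff.2 fun _ hj => measurable_sigmaOn (h hj)

lemma sigmaOn_union (S T : Set J) : sigmaOn X (S ∪ T) = sigmaOn X S ⊔ sigmaOn X T :=
  iSup_union

variable [mΩ : MeasurableSpace Ω]

lemma sigmaOn_le (hX : ∀ j, Measurable (X j)) (S : Set J) : sigmaOn X S ≤ mΩ :=
  sigmaOn_le_iff.2 fun j _ => hX j

lemma indep_sigmaOn {P : Measure Ω} (hX : ∀ j, Measurable (X j)) (h : iIndepFun X P) {S T : Set J}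
    (hST : Disjoint S T) : Indep (sigmaOn X S) (sigmaOn X T) P :=
  indep_iSup_of_disjoint (fun j => (hX j).comap_le) ((iIndepFun_iff_iIndep _ _ _).1 h) hST

end SigmaOn

/-- The variables of frozen percolation on a forest: every node `j` of the forest is on level `ℓ j`,
has the two children `c j 0` and `c j 1` on the next level, and carries the weight `U j` and the
time `Y j`. A rooted binary tree and the edges of a 3-regular tree, directed away from a root, are
instances. -/
structure IsFrozenForest {Ω J : Type*} [MeasurableSpace Ω] (P : Measure Ω) (ℓ : J → ℕ)
    (c : J → Fin 2 → J) (U : J → Ω → unitInterval) (Y : J → Ω → I) : Prop where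
  level_child : ∀ j k, ℓ (c j k) = ℓ j + 1
  child_injective : ∀ j j' k k', c j k = c j' k' → j = j' ∧ k = k'
  measurable_weight : ∀ j, Measurable (U j)
  measurable_time : ∀ j, Measurable (Y j)
  law_weight : ∀ j, P.map (U j) = volume
  indep_weight : iIndepFun U P
  law_time : ∀ j, P.map (Y j) = ν
  indep_level : ∀ n, iIndepFun (fun j : {j // ℓ j = n} => Y j.1) P
  recursion : ∀ j, ∀ᵐ ω ∂P, Y j ω = Φ (min (Y (c j 0) ω) (Y (c j 1) ω)) (U j ω)
  indep_earlier : ∀ n, Indep (sigmaOn Y {j | ℓ j = n}) (sigmaOn U {j | ℓ j < n}) P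

/-- The nodes of the subtree with root `i`. -/
def descendants {J : Type*} (c : J → Fin 2 → J) (i : J) : Set J :=
  {j | Relation.ReflTransGen (fun a b => ∃ k, c a k = b) i j}

section Descendants

variable {J : Type*} {c : J → Fin 2 → J}

lemma self_mem_descendants (i : J) : i ∈ descendants c i := Relation.ReflTransGen.refl

lemma descendants_child_subset (i : J) (k : Fin 2) : descendants c (c i k) ⊆ descendants c i :=
  fun _ hj => Relation.ReflTransGen.head ⟨k, rfl⟩ hj

end Descendants

/-- The conditional survival function of the time of `j`, given the times of its descendants `k`
levels further down. -/
noncomputable def condSurvival {Ω J : Type*} (c : J → Fin 2 → J) (Y : J → Ω → I) :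
    ℕ → J → Ω → ℝ → ℝ
  | 0, j, ω, x => exceed x (Y j ω)
  | k + 1, j, ω, x =>
    step (fun s => condSurvival c Y k (c j 0) ω s * condSurvival c Y k (c j 1) ω s) x

section CondSurvival

variable {Ω J : Type*} {c : J → Fin 2 → J} {Y : J → Ω → I}

lemma measurable_step [MeasurableSpace Ω] {r : Ω → ℝ → ℝ} (hr : Measurable (Function.uncurry r)) :
    Measurable (Function.uncurry fun ω x => step (r ω) x) := by
  have h : Measurable (Function.uncurry fun (p : Ω × ℝ) (s : ℝ) =>
      (Set.Ioc (1 / 2) p.2).indicator (r p.1) s) := by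
    have : (Function.uncurry fun (p : Ω × ℝ) (s : ℝ) => (Set.Ioc (1 / 2) p.2).indicator (r p.1) s)
        = {q : (Ω × ℝ) × ℝ | 1 / 2 < q.2 ∧ q.2 ≤ q.1.2}.indicator
          (fun q => Function.uncurry r (q.1.1, q.2)) := by
      ext q
      simp [Set.indicator, Function.uncurry]
    rw [this]
    refine Measurable.indicator (hr.comp (by fun_prop)) ?_
    exact (measurableSet_lt measurable_const measurable_snd).inter
      (measurableSet_le measurable_snd (by fun_prop))
  have h2 := (h.stronglyMeasurable.integral_prod_right (ν := volume)).measurable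
  have h3 : (fun p : Ω × ℝ => ∫ s, (Set.Ioc (1 / 2) p.2).indicator (r p.1) s)
      = fun p : Ω × ℝ => ∫ s in Set.Ioc (1 / 2) p.2, r p.1 s := by
    ext p
    exact integral_indicator measurableSet_Ioc
  have h4 : Measurable (fun p : Ω × ℝ => ∫ s in Set.Ioc (1 / 2) p.2, r p.1 s) := by
    rw [← h3]; exact h2
  exact (measurable_const.add (measurable_snd.mul hr)).sub h4

lemma measurable_condSurvival [MeasurableSpace Ω] {ℓ : J → ℕ} (hℓ : ∀ j k, ℓ (c j k) = ℓ j + 1)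
    (k : ℕ) (j : J) (hY : ∀ j' ∈ descendants c j, ℓ j' = ℓ j + k → Measurable (Y j')) :
    Measurable (Function.uncurry (condSurvival c Y k j)) := by
  induction k generalizing j with
  | zero =>
    have := hY j (self_mem_descendants j) rfl
    exact measurable_exceed_uncurry.comp (measurable_snd.prodMk (this.comp measurable_fst))
  | succ k ih =>
    have h : ∀ i, Measurable (Function.uncurry (condSurvival c Y k (c j i))) := fun i =>
      ih _ fun j' hj' hl => hY j' (descendants_child_subset j i hj') (by rw [hl, hℓ]; ring)
    exact measurable_step ((h 0).mul (h 1))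

lemma condSurvival_antitoneOn_and_mem (k : ℕ) (j : J) (ω : Ω) :
    AntitoneOn (condSurvival c Y k j ω) (Set.Icc (1 / 2) 1) ∧
      ∀ x ∈ Set.Icc (1 / 2 : ℝ) 1, condSurvival c Y k j ω x ∈ Set.Icc (0 : ℝ) 1 := by
  induction k generalizing j with
  | zero =>
    exact ⟨(exceed_antitone _).antitoneOn _, fun x _ => ⟨exceed_nonneg _ _, exceed_le_one _ _⟩⟩
  | succ k ih =>
    obtain ⟨h0, h0'⟩ := ih (c j 0)
    obtain ⟨h1, h1'⟩ := ih (c j 1)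
    have h : AntitoneOn
        (fun s => condSurvival c Y k (c j 0) ω s * condSurvival c Y k (c j 1) ω s)
        (Set.Icc (1 / 2) 1) := fun x hx y hy hxy =>
      mul_le_mul (h0 hx hy hxy) (h1 hx hy hxy) (h1' y hy).1 (h0' x hx).1
    exact ⟨step_antitoneOn h, fun x hx => step_mem_Icc h (fun s hs =>
      ⟨mul_nonneg (h0' s hs).1 (h1' s hs).1,
        mul_le_one₀ (h0' s hs).2 (h1' s hs).1 (h1' s hs).2⟩) hx⟩

lemma condSurvival_mem_Icc (k : ℕ) (j : J) (ω : Ω) {x : ℝ} (hx : x ∈ Set.Icc (1 / 2 : ℝ) 1) :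
    condSurvival c Y k j ω x ∈ Set.Icc (0 : ℝ) 1 :=
  (condSurvival_antitoneOn_and_mem k j ω).2 x hx

end CondSurvival

namespace IsFrozenForest

variable {Ω J : Type*} [mΩ : MeasurableSpace Ω] {P : Measure Ω} {ℓ : J → ℕ}
  {c : J → Fin 2 → J} {U : J → Ω → unitInterval} {Y : J → Ω → I}

lemma level_le (h : IsFrozenForest P ℓ c U Y) {i j : J} (hj : j ∈ descendants c i) : ℓ i ≤ ℓ j := by
  induction hj with
  | refl => exact le_rfl
  | tail _ hbc ih =>
    obtain ⟨k, rfl⟩ := hbc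
    rw [h.level_child]; omega

/-- Subtrees whose roots are on the same level are disjoint or equal. -/
lemma eq_of_mem_descendants (h : IsFrozenForest P ℓ c U Y) {i i' j : J} (hj : j ∈ descendants c i)
    (hj' : j ∈ descendants c i') (hi : ℓ i = ℓ i') : i = i' := by
  induction hj with
  | refl =>
    rcases Relation.ReflTransGen.cases_tail hj' with h1 | ⟨b, hb, k, rfl⟩
    · exact h1
    · have := h.level_le hb
      rw [h.level_child] at hi; omega
  | @tail b d hb hbc ih =>
    obtain ⟨k, rfl⟩ := hbc
    rcases Relation.ReflTransGen.cases_tail hj' with h1 | ⟨b', hb', k', hk'⟩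
    · have := h.level_le hb
      rw [← h1, h.level_child] at hi; omega
    · obtain ⟨rfl, -⟩ := h.child_injective _ _ _ _ hk'
      exact ih hb'

lemma child_zero_ne_child_one (h : IsFrozenForest P ℓ c U Y) (i : J) : c i 0 ≠ c i 1 := fun he =>
  absurd (h.child_injective _ _ _ _ he).2 (by decide)

lemma notMem_descendants_child (h : IsFrozenForest P ℓ c U Y) (i : J) (k : Fin 2) :
    i ∉ descendants c (c i k) := fun hi => by
  have := h.level_le hi
  rw [h.level_child] at this; omega

lemma indep_sigmaOn_time (h : IsFrozenForest P ℓ c U Y) {n : ℕ} {S T : Set J}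
    (hS : ∀ j ∈ S, ℓ j = n) (hT : ∀ j ∈ T, ℓ j = n) (hST : Disjoint S T) :
    Indep (sigmaOn Y S) (sigmaOn Y T) P := by
  have h1 := indep_sigmaOn (S := {j : {j // ℓ j = n} | j.1 ∈ S})
    (T := {j : {j // ℓ j = n} | j.1 ∈ T})
    (fun j => h.measurable_time j.1) (h.indep_level n)
    (Set.disjoint_left.2 fun j hjS hjT => Set.disjoint_left.1 hST hjS hjT)
  refine indep_of_indep_of_le h1 (sigmaOn_le_iff.2 fun j hj => ?_)
    (sigmaOn_le_iff.2 fun j hj => ?_)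
  · exact measurable_sigmaOn (X := fun j : {j // ℓ j = n} => Y j.1) (j := ⟨j, hS j hj⟩) hj
  · exact measurable_sigmaOn (X := fun j : {j // ℓ j = n} => Y j.1) (j := ⟨j, hT j hj⟩) hj

lemma measurable_condSurvival_uncurry (h : IsFrozenForest P ℓ c U Y) (k : ℕ) (j : J) :
    Measurable (Function.uncurry (condSurvival c Y k j)) :=
  measurable_condSurvival h.level_child k j fun j' _ _ => h.measurable_time j'

lemma measurable_condSurvival_sigmaOn (h : IsFrozenForest P ℓ c U Y) (k : ℕ) (j : J) (x : ℝ) :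
    Measurable[sigmaOn Y {j' | j' ∈ descendants c j ∧ ℓ j' = ℓ j + k}]
      (fun ω => condSurvival c Y k j ω x) := by
  have h1 := @measurable_condSurvival Ω J c Y
    (sigmaOn Y {j' | j' ∈ descendants c j ∧ ℓ j' = ℓ j + k}) ℓ h.level_child k j
    (fun j' hj' hl => measurable_sigmaOn
      (S := {j' | j' ∈ descendants c j ∧ ℓ j' = ℓ j + k}) ⟨hj', hl⟩)
  exact h1.comp (@Measurable.prodMk _ _ _ _ _ (_) _ _ measurable_id measurable_const)

lemma integral_exceed (h : IsFrozenForest P ℓ c U Y) (j : J) {x : ℝ}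
    (hx : x ∈ Set.Icc (1 / 2 : ℝ) 1) : ∫ ω, exceed x (Y j ω) ∂P = 1 / (2 * x) := by
  have h1 : Measurable (fun y => exceed x y) :=
    measurable_one.indicator (measurableSet_exceed x)
  rw [← integral_map (f := fun y => exceed x y) (h.measurable_time j).aemeasurable
    h1.aestronglyMeasurable, h.law_time]
  have h2 : ∫ y, exceed x y ∂ν = ν.real {y : I | ENNReal.ofReal x < (y : ℝ≥0∞)} :=
    integral_indicator_one (measurableSet_exceed x)
  have : 0 < x := by linarith [hx.1]
  rw [h2, measureReal_def, nu_exceed hx, ENNReal.toReal_ofReal (by positivity)]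

variable [IsProbabilityMeasure P]

/-- The conditional survival functions given the times `k` levels further down approach the
survival function of `ν` geometrically as `k → ∞`. -/
lemma variance_condSurvival_le (h : IsFrozenForest P ℓ c U Y) (k : ℕ) (j : J) {x : ℝ}
    (hx : x ∈ Set.Icc (1 / 2 : ℝ) 1) :
    ∫ ω, condSurvival c Y k j ω x ∂P = 1 / (2 * x) ∧
      ∫ ω, (condSurvival c Y k j ω x - 1 / (2 * x)) ^ 2 ∂P
        ≤ (14 / 15) ^ k * Real.exp (150 * x) := by
  induction k generalizing j x with
  | zero =>
    have h1 := h.integral_exceed j hx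
    refine ⟨h1, ?_⟩
    have hm : Measurable (fun ω => exceed x (Y j ω)) :=
      (measurable_one.indicator (measurableSet_exceed x)).comp (h.measurable_time j)
    have hm2 : 1 / 2 ≤ 1 / (2 * x) :=
      one_div_le_one_div_of_le (by linarith [hx.1]) (by linarith [hx.2])
    have h2 := (integral_sq_sub_le hm (fun ω => ⟨exceed_nonneg _ _, exceed_le_one _ _⟩) hm2 h1).2
    refine h2.trans ?_
    have h3 : 1 / (2 * x) ≤ 1 := by
      rw [div_le_one (by linarith [hx.1])]; linarith [hx.1]
    have h4 : 1 ≤ Real.exp (150 * x) := Real.one_le_exp (by linarith [hx.1])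
    rw [pow_zero, one_mul]
    exact (pow_le_one₀ (by linarith) h3).trans h4
  | succ k ih =>
    have hind : ∀ x, IndepFun (fun ω => condSurvival c Y k (c j 0) ω x)
        (fun ω => condSurvival c Y k (c j 1) ω x) P := fun x => by
      refine (IndepFun_iff_Indep _ _ _).2 (indep_of_indep_of_le
        (h.indep_sigmaOn_time (n := ℓ j + 1 + k)
          (S := {j' | j' ∈ descendants c (c j 0) ∧ ℓ j' = ℓ (c j 0) + k})
          (T := {j' | j' ∈ descendants c (c j 1) ∧ ℓ j' = ℓ (c j 1) + k})
          (fun j' hj' => by rw [hj'.2, h.level_child])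
          (fun j' hj' => by rw [hj'.2, h.level_child]) ?_)
        (h.measurable_condSurvival_sigmaOn k _ x).comap_le
        (h.measurable_condSurvival_sigmaOn k _ x).comap_le)
      refine Set.disjoint_left.2 fun j' h0 h1 => h.child_zero_ne_child_one j ?_
      exact h.eq_of_mem_descendants h0.1 h1.1 (by rw [h.level_child, h.level_child])
    have := step_contraction (B := (14 / 15) ^ k) (h.measurable_condSurvival_uncurry k (c j 0))
      (h.measurable_condSurvival_uncurry k (c j 1)) (fun ω x hx => condSurvival_mem_Icc k _ ω hx)
      (fun ω x hx => condSurvival_mem_Icc k _ ω hx) hind (fun x hx => (ih (c j 0) hx).1)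
      (fun x hx => (ih (c j 1) hx).1) (fun x hx => (ih (c j 0) hx).2)
      (fun x hx => (ih (c j 1) hx).2) hx
    rw [pow_succ']
    exact this

end IsFrozenForest

/-! ### Triviality of the tail of a forest -/

/-- Averaging over a uniform weight that is independent of everything else. -/
lemma integral_exceed_frozen_mul {Ω : Type*} [MeasurableSpace Ω] {P : Measure Ω}
    [IsProbabilityMeasure P] {U : Ω → unitInterval} {M : Ω → I} {Z : Ω → ℝ} (hU : Measurable U)
    (hM : Measurable M) (hZ : Measurable Z) (hlaw : P.map U = volume)
    (hind : IndepFun (fun ω => (M ω, Z ω)) U P) {C : ℝ} (hC : ∀ ω, |Z ω| ≤ C)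
    {x : ℝ} (hx : x ∈ Set.Icc (1 / 2 : ℝ) 1) :
    ∫ ω, exceed x (Φ (M ω) (U ω)) * Z ω ∂P
      = ∫ ω, step (fun s => exceed s (M ω)) x * Z ω ∂P := by
  have hMZ : Measurable (fun ω => (M ω, Z ω)) := hM.prodMk hZ
  have hex : Measurable (fun y => exceed x y) := measurable_one.indicator (measurableSet_exceed x)
  have hF : Measurable (fun q : (I × ℝ) × unitInterval => exceed x (Φ q.1.1 q.2) * q.1.2) :=
    (hex.comp (measurable_frozen.comp ((measurable_fst.comp measurable_fst).prodMk
      measurable_snd))).mul (measurable_snd.comp measurable_fst)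
  have hmap := (indepFun_iff_map_prod_eq_prod_map_map hMZ.aemeasurable hU.aemeasurable).1 hind
  rw [hlaw] at hmap
  have hint : Integrable (fun q : (I × ℝ) × unitInterval => exceed x (Φ q.1.1 q.2) * q.1.2)
      ((P.map fun ω => (M ω, Z ω)).prod volume) := by
    rw [← hmap, integrable_map_measure hF.aestronglyMeasurable (hMZ.prodMk hU).aemeasurable]
    refine Integrable.of_bound (hF.comp (hMZ.prodMk hU)).aestronglyMeasurable C
      (.of_forall fun ω => ?_)
    simp only [Function.comp, norm_mul, Real.norm_eq_abs]
    rw [abs_of_nonneg (exceed_nonneg _ _)]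
    exact (mul_le_of_le_one_left (abs_nonneg _) (exceed_le_one _ _)).trans (hC ω)
  have hstep : Measurable (fun q : I × ℝ => step (fun s => exceed s q.1) x * q.2) := by
    have h1 : Measurable (Function.uncurry fun (y : I) (s : ℝ) => exceed s y) :=
      measurable_exceed_uncurry.comp measurable_swap
    have h2 := (measurable_step h1).comp (by fun_prop : Measurable fun q : I × ℝ => (q.1, x))
    exact h2.mul measurable_snd
  calc ∫ ω, exceed x (Φ (M ω) (U ω)) * Z ω ∂P
      = ∫ q, exceed x (Φ q.1.1 q.2) * q.1.2 ∂((P.map fun ω => (M ω, Z ω)).prod volume) := by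
        rw [← hmap, integral_map (hMZ.prodMk hU).aemeasurable hF.aestronglyMeasurable]
    _ = ∫ q : I × ℝ, step (fun s => exceed s q.1) x * q.2 ∂(P.map fun ω => (M ω, Z ω)) := by
        rw [integral_prod _ hint]
        congr 1; ext q
        simp only
        rw [integral_mul_const, integral_exceed_frozen _ hx]
    _ = _ := by
        rw [integral_map hMZ.aemeasurable hstep.aestronglyMeasurable]

lemma measurable_min_time {Ω : Type*} {_ : MeasurableSpace Ω} {y y' : Ω → I} (hy : Measurable y)
    (hy' : Measurable y') : Measurable (fun ω => min (y ω) (y' ω)) := by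
  have h1 : Measurable (fun p : I × I => min p.1 p.2) := by
    have : (fun p : I × I => min p.1 p.2) = fun p => if (p.1 : ℝ≥0∞) ≤ p.2 then p.1 else p.2 := by
      ext p; rw [min_def]; rfl
    rw [this]
    exact Measurable.ite (measurableSet_le (measurable_subtype_coe.comp measurable_fst)
      (measurable_subtype_coe.comp measurable_snd)) measurable_fst measurable_snd
  exact h1.comp (hy.prodMk hy')

section SigmaAlgebras

variable {Ω J : Type*}

/-- The σ-algebra of all times from level `n` on and all weights, except for those of the nodes of
`A` above level `n`; null sets are adjoined, so that it determines further times. -/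
@[reducible] def outside [MeasurableSpace Ω] (P : Measure Ω) (ℓ : J → ℕ)
    (U : J → Ω → unitInterval) (Y : J → Ω → I)
    (A : Set J) (n : ℕ) : MeasurableSpace Ω :=
  aeClosure P (sigmaOn Y {j | n ≤ ℓ j} ⊔ sigmaOn U {j | j ∈ A → n ≤ ℓ j})

/-- The tail of a forest, generated by the times and the weights. -/
@[reducible] def forestTail (ℓ : J → ℕ) (U : J → Ω → unitInterval) (Y : J → Ω → I) :
    MeasurableSpace Ω :=
  ⨅ n, sigmaOn Y {j | n ≤ ℓ j} ⊔ sigmaOn U {j | n ≤ ℓ j}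

lemma forestTail_le_level (ℓ : J → ℕ) (U : J → Ω → unitInterval) (Y : J → Ω → I) (n : ℕ) :
    forestTail ℓ U Y ≤ sigmaOn Y {j | n ≤ ℓ j} ⊔ sigmaOn U {j | n ≤ ℓ j} :=
  iInf_le _ n

end SigmaAlgebras

namespace IsFrozenForest

variable {Ω J : Type*} {m : MeasurableSpace Ω} [mΩ : MeasurableSpace Ω] {P : Measure Ω} {ℓ : J → ℕ}
  {c : J → Fin 2 → J} {U : J → Ω → unitInterval} {Y : J → Ω → I}

/-- The time of `j` is a function of the times `k` levels further down and of the weights in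
between. -/
lemma measurable_time_aeClosure (h : IsFrozenForest P ℓ c U Y) (k : ℕ)
    (j : J) (hY : ∀ j' ∈ descendants c j, ℓ j' = ℓ j + k → Measurable[aeClosure P m] (Y j'))
    (hU : ∀ j' ∈ descendants c j, ℓ j' < ℓ j + k → Measurable[aeClosure P m] (U j')) :
    Measurable[aeClosure P m] (Y j) := by
  induction k generalizing j with
  | zero => exact hY j (self_mem_descendants j) rfl
  | succ k ih =>
    have h1 : ∀ i, Measurable[aeClosure P m] (Y (c j i)) := fun i =>
      ih _ (fun j' hj' hl => hY j' (descendants_child_subset j i hj')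
          (by rw [hl, h.level_child]; ring))
        (fun j' hj' hl => hU j' (descendants_child_subset j i hj')
          (by rw [h.level_child] at hl; omega))
    have h2 := hU j (self_mem_descendants j) (by omega)
    exact measurable_aeClosure_of_ae_eq (g := fun ω => Φ (min (Y (c j 0) ω) (Y (c j 1) ω)) (U j ω))
      (h.measurable_time j) (measurable_frozen.comp ((measurable_min_time (h1 0) (h1 1)).prodMk h2))
      (h.recursion j)

lemma monotone_aeClosure (h : IsFrozenForest P ℓ c U Y) {B : Set J} {n : ℕ}
    (hB : ∀ j, n ≤ ℓ j → j ∈ B) :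
    Monotone fun k => aeClosure P
      (sigmaOn Y {j | ℓ j = n + k} ⊔ sigmaOn U {j | j ∈ B ∧ ℓ j < n + k}) := by
  refine monotone_nat_of_le_succ fun k => aeClosure_mono ?_
  have hle : sigmaOn Y {j | ℓ j = n + (k + 1)} ⊔ sigmaOn U {j | j ∈ B ∧ ℓ j < n + (k + 1)} ≤ mΩ :=
    sup_le (sigmaOn_le h.measurable_time _) (sigmaOn_le h.measurable_weight _)
  have hY : ∀ j, ℓ j = n + (k + 1) → Measurable[aeClosure P (sigmaOn Y {j | ℓ j = n + (k + 1)} ⊔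
      sigmaOn U {j | j ∈ B ∧ ℓ j < n + (k + 1)})] (Y j) := fun j hj =>
    (measurable_sigmaOn (X := Y) (S := {j | ℓ j = n + (k + 1)}) hj).mono
      (le_sup_left.trans (le_aeClosure hle)) le_rfl
  have hU : ∀ j, j ∈ B → ℓ j < n + (k + 1) → Measurable[aeClosure P
      (sigmaOn Y {j | ℓ j = n + (k + 1)} ⊔ sigmaOn U {j | j ∈ B ∧ ℓ j < n + (k + 1)})] (U j) :=
    fun j hj hj' =>
      (measurable_sigmaOn (X := U) (S := {j | j ∈ B ∧ ℓ j < n + (k + 1)}) ⟨hj, hj'⟩).mono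
        (le_sup_right.trans (le_aeClosure hle)) le_rfl
  refine sup_le (sigmaOn_le_iff.2 fun j (hj : ℓ j = n + k) => ?_)
    (sigmaOn_le_iff.2 fun j hj => hU j hj.1 (by have := hj.2; omega))
  exact h.measurable_time_aeClosure 1 j (fun j' _ hl => hY j' (by rw [hl, hj]; ring))
    (fun j' hj' hl => hU j' (hB j' (by have := h.level_le hj'; omega)) (by omega))

/-- The σ-algebra of all times from level `n` on and the weights of `B` is exhausted, up to null
sets, by the σ-algebras of the times of one level and the weights of `B` above it. -/
lemma le_iSup_aeClosure (h : IsFrozenForest P ℓ c U Y) (B : Set J) (n : ℕ) :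
    sigmaOn Y {j | n ≤ ℓ j} ⊔ sigmaOn U B ≤ ⨆ k, aeClosure P
      (sigmaOn Y {j | ℓ j = n + k} ⊔ sigmaOn U {j | j ∈ B ∧ ℓ j < n + k}) := by
  have hle : ∀ k, sigmaOn Y {j | ℓ j = n + k} ⊔ sigmaOn U {j | j ∈ B ∧ ℓ j < n + k} ≤ mΩ :=
    fun k => sup_le (sigmaOn_le h.measurable_time _) (sigmaOn_le h.measurable_weight _)
  have hsup := fun k => (le_aeClosure (P := P) (hle k)).trans (le_iSup (fun k => aeClosure P
      (sigmaOn Y {j | ℓ j = n + k} ⊔ sigmaOn U {j | j ∈ B ∧ ℓ j < n + k})) k)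
  refine sup_le (sigmaOn_le_iff.2 fun j (hj : n ≤ ℓ j) => ?_) (sigmaOn_le_iff.2 fun j hj => ?_)
  · exact (measurable_sigmaOn (X := Y) (S := {j' | ℓ j' = n + (ℓ j - n)})
      (show ℓ j = n + (ℓ j - n) by omega)).mono (le_sup_left.trans (hsup _)) le_rfl
  · exact (measurable_sigmaOn (X := U) (S := {j' | j' ∈ B ∧ ℓ j' < n + (ℓ j + 1)})
      ⟨hj, by omega⟩).mono (le_sup_right.trans (hsup _)) le_rfl

lemma measurable_time_outside (h : IsFrozenForest P ℓ c U Y) {A : Set J} {j : J} {n : ℕ}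
    (hj : n ≤ ℓ j) : Measurable[outside P ℓ U Y A n] (Y j) :=
  (measurable_sigmaOn (X := Y) (S := {j | n ≤ ℓ j}) hj).mono (le_sup_left.trans (le_aeClosure
    (sup_le (sigmaOn_le h.measurable_time _) (sigmaOn_le h.measurable_weight _)))) le_rfl

lemma measurable_weight_outside (h : IsFrozenForest P ℓ c U Y) {A : Set J} {j : J} {n : ℕ}
    (hj : j ∈ A → n ≤ ℓ j) : Measurable[outside P ℓ U Y A n] (U j) :=
  (measurable_sigmaOn (X := U) (S := {j | j ∈ A → n ≤ ℓ j}) hj).mono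
    (le_sup_right.trans (le_aeClosure
      (sup_le (sigmaOn_le h.measurable_time _) (sigmaOn_le h.measurable_weight _)))) le_rfl

lemma outside_anti (h : IsFrozenForest P ℓ c U Y) {A B : Set J} (hAB : A ⊆ B) (n : ℕ) :
    outside P ℓ U Y B n ≤ outside P ℓ U Y A n :=
  aeClosure_mono (sup_le (sigmaOn_le_iff.2 fun _ hj => h.measurable_time_outside hj)
    (sigmaOn_le_iff.2 fun _ hj => h.measurable_weight_outside fun hjA => hj (hAB hjA)))

/-- The time of a node is determined outside `A` if its subtree avoids `A`. -/
lemma measurable_time_outside_of_disjoint (h : IsFrozenForest P ℓ c U Y) {A : Set J} {j : J} {n : ℕ}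
    (hj : ∀ j' ∈ descendants c j, j' ∉ A) (hn : ℓ j ≤ n) : Measurable[outside P ℓ U Y A n] (Y j) :=
  h.measurable_time_aeClosure (n - ℓ j) j
    (fun _ _ hl => h.measurable_time_outside (by omega))
    (fun _ hj' _ => h.measurable_weight_outside fun hjA => absurd hjA (hj _ hj'))

/-- Subtrees with different roots on one level do not meet. -/
lemma notMem_descendants_of_ne (h : IsFrozenForest P ℓ c U Y) {i j : J} (hl : ℓ j = ℓ i)
    (hne : j ≠ i) : ∀ j' ∈ descendants c j, j' ∉ descendants c i := fun _ hj hi =>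
  hne (h.eq_of_mem_descendants hj hi hl)

lemma measurable_condSurvival_outside (h : IsFrozenForest P ℓ c U Y) (A : Set J) (j : J) {k n : ℕ}
    (hn : n = ℓ j + k) (x : ℝ) :
    Measurable[outside P ℓ U Y A n] (fun ω => condSurvival c Y k j ω x) :=
  (h.measurable_condSurvival_sigmaOn k j x).mono
    (sigmaOn_le_iff.2 fun _ hj => h.measurable_time_outside (by rw [hn, hj.2])) le_rfl

lemma forestTail_le (h : IsFrozenForest P ℓ c U Y) : forestTail ℓ U Y ≤ mΩ :=
  (forestTail_le_level ℓ U Y 0).trans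
    (sup_le (sigmaOn_le h.measurable_time _) (sigmaOn_le h.measurable_weight _))

variable [IsProbabilityMeasure P]

/-- The weights of a set `A` of nodes above level `n` are independent of all times from level `n` on
together with all other weights. -/
lemma indep_weight_future (h : IsFrozenForest P ℓ c U Y) {A : Set J} {n : ℕ}
    (hA : ∀ j ∈ A, ℓ j < n) :
    Indep (sigmaOn U A) (sigmaOn Y {j | n ≤ ℓ j} ⊔ sigmaOn U Aᶜ) P := by
  have hU := sigmaOn_le (X := U) h.measurable_weight
  have hY := sigmaOn_le (X := Y) h.measurable_time
  have h1 : ∀ k, Indep (aeClosure P (sigmaOn Y {j | ℓ j = n + k} ⊔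
      sigmaOn U {j | j ∈ Aᶜ ∧ ℓ j < n + k})) (sigmaOn U A) P := by
    intro k
    refine (indep_aeClosure_right ?_).symm
    rw [sup_comm]
    refine indep_sup_of_indep (hU _) (hU _) (hY _) ?_ ?_
    · exact indep_sigmaOn h.measurable_weight h.indep_weight
        (Set.disjoint_left.2 fun j hj hj' => hj'.1 hj)
    · refine indep_of_indep_of_le_right (h.indep_earlier (n + k)) (sup_le ?_ ?_)
      · exact sigmaOn_mono fun j hj => (hA j hj).trans_le (Nat.le_add_right n k)
      · exact sigmaOn_mono fun j hj => hj.2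
  exact (indep_of_indep_of_le_left (indep_iSup_of_monotone h1 (fun _ => aeClosure_le _) (hU _)
    (h.monotone_aeClosure fun j hj hjA => absurd (hA j hjA) (not_lt.2 hj)))
    (h.le_iSup_aeClosure _ _)).symm

lemma indep_weight_outside (h : IsFrozenForest P ℓ c U Y) {i : J} {n : ℕ} (hi : ℓ i < n) :
    Indep (sigmaOn U {i}) (outside P ℓ U Y {i} n) P := by
  refine indep_aeClosure_right (indep_of_indep_of_le_right
    (h.indep_weight_future (A := {i}) (n := n)
    fun j hj => by rwa [Set.mem_singleton_iff.1 hj]) (sup_le_sup_left (sigmaOn_mono ?_) _))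
  rintro j hj rfl
  exact absurd (hj rfl) (not_le.2 hi)

/-- `condSurvival c Y k i` is the conditional survival function of the time of `i` given everything
outside the part of the subtree of `i` that lies less than `k` levels below `i`. -/
lemma integral_exceed_mul (h : IsFrozenForest P ℓ c U Y) (k : ℕ) (i : J) {Z : Ω → ℝ}
    (hZ : Measurable[outside P ℓ U Y (descendants c i) (ℓ i + k)] Z) {C : ℝ}
    (hC : ∀ ω, |Z ω| ≤ C) {x : ℝ}
    (hx : x ∈ Set.Icc (1 / 2 : ℝ) 1) :
    ∫ ω, exceed x (Y i ω) * Z ω ∂P = ∫ ω, condSurvival c Y k i ω x * Z ω ∂P := by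
  induction k generalizing i Z x with
  | zero => rfl
  | succ k ih =>
    have hlev : ∀ e, ℓ (c i e) + k = ℓ i + (k + 1) := fun e => by rw [h.level_child]; ring
    have hZm : Measurable Z := hZ.mono (aeClosure_le _) le_rfl
    have hexm : ∀ s, Measurable (fun y => exceed s y) := fun s =>
      measurable_one.indicator (measurableSet_exceed s)
    -- the two subtrees below `i` are integrated out one after the other
    have hchild : ∀ s ∈ Set.Icc (1 / 2 : ℝ) 1,
        ∫ ω, exceed s (min (Y (c i 0) ω) (Y (c i 1) ω)) * Z ω ∂P
          = ∫ ω, condSurvival c Y k (c i 0) ω s * condSurvival c Y k (c i 1) ω s * Z ω ∂P := by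
      intro s hs
      have h1 : ∫ ω, exceed s (Y (c i 0) ω) * (exceed s (Y (c i 1) ω) * Z ω) ∂P
          = ∫ ω, condSurvival c Y k (c i 0) ω s * (exceed s (Y (c i 1) ω) * Z ω) ∂P := by
        refine ih (c i 0) ?_ (fun ω => ?_) hs
        · rw [hlev]
          refine Measurable.mul ((hexm s).comp (h.measurable_time_outside_of_disjoint
            (h.notMem_descendants_of_ne ?_ (h.child_zero_ne_child_one i).symm) ?_)) ?_
          · rw [h.level_child, h.level_child]
          · rw [← hlev 1]; omega
          · exact hZ.mono (h.outside_anti (descendants_child_subset i 0) _) le_rfl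
        · rw [abs_mul, abs_of_nonneg (exceed_nonneg _ _)]
          exact (mul_le_of_le_one_left (abs_nonneg _) (exceed_le_one _ _)).trans (hC ω)
      have h2 : ∫ ω, exceed s (Y (c i 1) ω) * (condSurvival c Y k (c i 0) ω s * Z ω) ∂P
          = ∫ ω, condSurvival c Y k (c i 1) ω s * (condSurvival c Y k (c i 0) ω s * Z ω) ∂P := by
        refine ih (c i 1) ?_ (fun ω => ?_) hs
        · rw [hlev]
          exact Measurable.mul (h.measurable_condSurvival_outside _ _ (hlev 0).symm s)
            (hZ.mono (h.outside_anti (descendants_child_subset i 1) _) le_rfl)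
        · have := condSurvival_mem_Icc (c := c) (Y := Y) k (c i 0) ω hs
          rw [abs_mul, abs_of_nonneg this.1]
          exact (mul_le_of_le_one_left (abs_nonneg _) this.2).trans (hC ω)
      calc _ = ∫ ω, exceed s (Y (c i 0) ω) * (exceed s (Y (c i 1) ω) * Z ω) ∂P := by
            congr 1; ext ω; rw [exceed_min]; ring
        _ = ∫ ω, exceed s (Y (c i 1) ω) * (condSurvival c Y k (c i 0) ω s * Z ω) ∂P := by
            rw [h1]; congr 1; ext ω; ring
        _ = _ := by
            rw [h2]; congr 1; ext ω; ring
    have hMm : Measurable (fun ω => min (Y (c i 0) ω) (Y (c i 1) ω)) :=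
      measurable_min_time (h.measurable_time _) (h.measurable_time _)
    have hind : IndepFun (fun ω => (min (Y (c i 0) ω) (Y (c i 1) ω), Z ω)) (U i) P := by
      have h1 := (h.indep_weight_outside (i := i) (n := ℓ i + (k + 1)) (by omega)).symm
      have hZ' : Measurable[outside P ℓ U Y {i} (ℓ i + (k + 1))] Z :=
        hZ.mono (h.outside_anti (Set.singleton_subset_iff.2 (self_mem_descendants i)) _) le_rfl
      have hYc : ∀ e, Measurable[outside P ℓ U Y {i} (ℓ i + (k + 1))] (Y (c i e)) := fun e => by
        refine h.measurable_time_outside_of_disjoint (fun j hj hji => ?_) (by rw [← hlev e]; omega)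
        rw [Set.mem_singleton_iff.1 hji] at hj
        exact h.notMem_descendants_child i e hj
      refine (IndepFun_iff_Indep _ _ _).2 (indep_of_indep_of_le h1 ?_ ?_)
      · exact ((measurable_min_time (hYc 0) (hYc 1)).prodMk hZ').comap_le
      · exact (measurable_sigmaOn (X := U) (S := {i}) rfl).comap_le
    have h1 : ∫ ω, exceed x (Y i ω) * Z ω ∂P
        = ∫ ω, step (fun s => exceed s (min (Y (c i 0) ω) (Y (c i 1) ω))) x * Z ω ∂P := by
      rw [← integral_exceed_frozen_mul (h.measurable_weight i) hMm hZm (h.law_weight i) hind hC hx]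
      refine integral_congr_ae ?_
      filter_upwards [h.recursion i] with ω hω
      rw [hω]
    have hsub : ∀ s ∈ Set.Ioc (1 / 2) x, s ∈ Set.Icc (1 / 2 : ℝ) 1 :=
      fun s hs => ⟨hs.1.le, hs.2.trans hx.2⟩
    rw [h1, integral_step_mul (r := fun ω s => exceed s (min (Y (c i 0) ω) (Y (c i 1) ω)))
        (measurable_exceed_uncurry.comp (measurable_snd.prodMk (hMm.comp measurable_fst)))
        (fun ω s _ => ⟨exceed_nonneg _ _, exceed_le_one _ _⟩) hZm hC hx,
      hchild x hx, setIntegral_congr_fun measurableSet_Ioc (fun s hs => hchild s (hsub s hs))]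
    refine (integral_step_mul
      (r := fun ω s => condSurvival c Y k (c i 0) ω s * condSurvival c Y k (c i 1) ω s)
      ((h.measurable_condSurvival_uncurry k _).mul (h.measurable_condSurvival_uncurry k _))
      (fun ω s hs => ?_) hZm hC hx).symm
    have h0 := condSurvival_mem_Icc (c := c) (Y := Y) k (c i 0) ω hs
    have h1 := condSurvival_mem_Icc (c := c) (Y := Y) k (c i 1) ω hs
    exact ⟨mul_nonneg h0.1 h1.1, mul_le_one₀ h0.2 h1.1 h1.2⟩

/-- The time of `i` is independent of the events that, for every `k`, are determined outside the
part of the subtree of `i` less than `k` levels below `i`. -/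
lemma indep_time_outside (h : IsFrozenForest P ℓ c U Y) (i : J) :
    Indep (MeasurableSpace.comap (Y i) inferInstance)
      (⨅ k, outside P ℓ U Y (descendants c i) (ℓ i + k)) P := by
  have hgen : MeasurableSpace.comap (Y i) inferInstance = MeasurableSpace.generateFrom
      {s | ∃ t ∈ {s | ∃ x ∈ Set.Icc (1 / 2 : ℝ) 1, {y : I | ENNReal.ofReal x < (y : ℝ≥0∞)} = s},
        Y i ⁻¹' t = s} := by
    rw [generateFrom_exceed, MeasurableSpace.comap_generateFrom]; rfl
  refine IndepSets.indep (h.measurable_time i).comap_le ((iInf_le _ 0).trans (aeClosure_le _))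
    (isPiSystem_exceed.comap _) (@MeasurableSpace.isPiSystem_measurableSet Ω
      (⨅ k, outside P ℓ U Y (descendants c i) (ℓ i + k))) hgen
    (@MeasurableSpace.generateFrom_measurableSet Ω
      (⨅ k, outside P ℓ U Y (descendants c i) (ℓ i + k))).symm ?_
  rw [IndepSets_iff]
  rintro _ C ⟨_, ⟨x, hx, rfl⟩, rfl⟩
    (hC : MeasurableSet[⨅ k, outside P ℓ U Y (descendants c i) (ℓ i + k)] C)
  set S := Y i ⁻¹' {y : I | ENNReal.ofReal x < (y : ℝ≥0∞)} with hS
  have hSm : MeasurableSet S := h.measurable_time i (measurableSet_exceed x)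
  have hCk : ∀ k, MeasurableSet[outside P ℓ U Y (descendants c i) (ℓ i + k)] C := fun k =>
    (iInf_le (fun k => outside P ℓ U Y (descendants c i) (ℓ i + k)) k) C hC
  have hCm : MeasurableSet C := aeClosure_le _ C (hCk 0)
  have hZ : ∀ ω, |C.indicator (1 : Ω → ℝ) ω| ≤ 1 := fun ω => by
    by_cases hω : ω ∈ C <;> simp [hω]
  have hZm : Measurable (C.indicator (1 : Ω → ℝ)) := measurable_one.indicator hCm
  have h1 : ∫ ω, exceed x (Y i ω) * C.indicator 1 ω ∂P = P.real (S ∩ C) := by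
    rw [← integral_indicator_one (hSm.inter hCm)]
    congr 1; ext ω
    rw [Set.inter_indicator_one]; rfl
  have hx0 : 0 < x := by linarith [hx.1]
  have hbound : ∀ k, |P.real (S ∩ C) - 1 / (2 * x) * P.real C|
      ≤ √((14 / 15) ^ k * Real.exp (150 * x)) := by
    intro k
    have h2 := h.integral_exceed_mul k i (Z := C.indicator (1 : Ω → ℝ))
      (measurable_const.indicator (hCk k)) hZ hx
    have hpm : Measurable (fun ω => condSurvival c Y k i ω x) :=
      (h.measurable_condSurvival_uncurry k i).comp (by fun_prop : Measurable fun ω => (ω, x))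
    have hp01 := fun ω => condSurvival_mem_Icc (c := c) (Y := Y) k i ω hx
    have hpi : Integrable (fun ω => condSurvival c Y k i ω x) P :=
      Integrable.of_bound hpm.aestronglyMeasurable 1 (.of_forall fun ω => by
        rw [Real.norm_eq_abs, abs_of_nonneg (hp01 ω).1]; exact (hp01 ω).2)
    have hdi : Integrable (fun ω => condSurvival c Y k i ω x - 1 / (2 * x)) P :=
      hpi.sub (integrable_const _)
    have hZi : Integrable (C.indicator (1 : Ω → ℝ)) P :=
      Integrable.of_bound hZm.aestronglyMeasurable 1 (.of_forall hZ)
    have hpZ : Integrable (fun ω => condSurvival c Y k i ω x * C.indicator 1 ω) P :=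
      hpi.mul_bdd (c := 1) hZm.aestronglyMeasurable (.of_forall hZ)
    have h3 : P.real (S ∩ C) - 1 / (2 * x) * P.real C
        = ∫ ω, (condSurvival c Y k i ω x - 1 / (2 * x)) * C.indicator 1 ω ∂P := by
      simp only [sub_mul]
      rw [integral_sub hpZ (hZi.const_mul _), integral_const_mul, integral_indicator_one hCm, ← h2,
        h1]
    have h4 : MemLp (fun ω => condSurvival c Y k i ω x - 1 / (2 * x)) 2 P :=
      MemLp.of_bound hdi.aestronglyMeasurable (1 + |1 / (2 * x)|) (.of_forall fun ω => by
        rw [Real.norm_eq_abs]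
        refine (abs_sub _ _).trans (add_le_add_left ?_ _)
        rw [abs_of_nonneg (hp01 ω).1]; exact (hp01 ω).2)
    rw [h3]
    refine Real.abs_le_sqrt ?_
    calc (∫ ω, (condSurvival c Y k i ω x - 1 / (2 * x)) * C.indicator 1 ω ∂P) ^ 2
        ≤ (∫ ω, |condSurvival c Y k i ω x - 1 / (2 * x)| ∂P) ^ 2 := by
          rw [← sq_abs]
          gcongr
          refine (abs_integral_le_integral_abs).trans (integral_mono_of_nonneg
            (.of_forall fun _ => abs_nonneg _) hdi.abs (.of_forall fun ω => ?_))
          simp only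
          rw [abs_mul]
          exact mul_le_of_le_one_right (abs_nonneg _) (hZ ω)
      _ ≤ ∫ ω, |condSurvival c Y k i ω x - 1 / (2 * x)| ^ 2 ∂P := by
          have := variance_nonneg (fun ω => |condSurvival c Y k i ω x - 1 / (2 * x)|) P
          rw [variance_eq_sub (show MemLp (fun ω => |condSurvival c Y k i ω x - 1 / (2 * x)|) 2 P
            from h4.abs)] at this
          simpa using this
      _ ≤ _ := by
          simp only [sq_abs]
          exact (h.variance_condSurvival_le k i hx).2
  have hlim : Filter.Tendsto (fun k : ℕ => √((14 / 15 : ℝ) ^ k * Real.exp (150 * x)))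
      Filter.atTop (nhds 0) := by
    have := (tendsto_pow_atTop_nhds_zero_of_lt_one (r := (14 / 15 : ℝ)) (by norm_num)
      (by norm_num)).mul_const (Real.exp (150 * x))
    rw [zero_mul] at this
    simpa using this.sqrt
  have h5 : P.real (S ∩ C) = 1 / (2 * x) * P.real C :=
    sub_eq_zero.1 (abs_nonpos_iff.1 (ge_of_tendsto' hlim hbound))
  have h6 : P S = ENNReal.ofReal (1 / (2 * x)) := by
    rw [← nu_exceed hx, ← h.law_time i, Measure.map_apply (h.measurable_time i)
      (measurableSet_exceed x)]
  rw [h6, ← ofReal_measureReal (s := S ∩ C), ← ofReal_measureReal (s := C), h5,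
    ENNReal.ofReal_mul (by positivity)]

/-- The tail of a forest is independent of the weights above a level together with finitely many
times of that level, which are added one at a time. -/
lemma indep_tail_finset (h : IsFrozenForest P ℓ c U Y) {N : ℕ} (s : Finset {j // ℓ j = N}) :
    Indep (forestTail ℓ U Y)
      (sigmaOn U {j | ℓ j < N} ⊔ sigmaOn Y (Subtype.val '' (s : Set {j // ℓ j = N}))) P := by
  classical
  have hU := sigmaOn_le (X := U) h.measurable_weight
  have hY := sigmaOn_le (X := Y) h.measurable_time
  have hHn := forestTail_le_level ℓ U Y
  have hH := h.forestTail_le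
  induction s using Finset.induction_on with
  | empty =>
    simp only [Finset.coe_empty, Set.image_empty, sigmaOn, Set.mem_empty_iff_false, iSup_false,
      iSup_bot, sup_bot_eq]
    refine (indep_of_indep_of_le_right (h.indep_weight_future (A := {j | ℓ j < N}) (n := N)
      fun j hj => hj) ((hHn N).trans (sup_le_sup_left (sigmaOn_mono ?_) _))).symm
    exact fun j (hj : N ≤ ℓ j) => show ¬ ℓ j < N from not_lt.2 hj
  | insert i s his ih =>
    have h1 : sigmaOn U {j | ℓ j < N}
          ⊔ sigmaOn Y (Subtype.val '' ((insert i s : Finset {j // ℓ j = N}) : Set {j // ℓ j = N}))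
        = sigmaOn U {j | ℓ j < N} ⊔ sigmaOn Y (Subtype.val '' (s : Set {j // ℓ j = N}))
          ⊔ MeasurableSpace.comap (Y i) inferInstance := by
      rw [Finset.coe_insert, Set.image_insert_eq, Set.insert_eq, sigmaOn_union, sup_assoc,
        sup_comm (sigmaOn Y _)]
      simp [sigmaOn]
    rw [h1]
    refine indep_sup_of_indep hH (sup_le (hU _) (hY _)) (h.measurable_time _).comap_le ih
      (indep_of_indep_of_le_right (h.indep_time_outside i.1) (le_iInf fun k => ?_))
    refine sup_le ((hHn (ℓ i.1 + k)).trans (sup_le ?_ ?_)) (sup_le ?_ ?_)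
    · exact sigmaOn_le_iff.2 fun j hj => h.measurable_time_outside hj
    · exact sigmaOn_le_iff.2 fun j hj => h.measurable_weight_outside fun _ => hj
    · refine sigmaOn_le_iff.2 fun j (hj : ℓ j < N) => h.measurable_weight_outside fun hji => ?_
      have := h.level_le hji
      rw [i.2] at this; omega
    · refine sigmaOn_le_iff.2 ?_
      rintro _ ⟨j, hj, rfl⟩
      refine h.measurable_time_outside_of_disjoint
        (h.notMem_descendants_of_ne (by rw [i.2, j.2]) ?_) (by rw [i.2, j.2]; omega)
      intro hij
      exact his (Subtype.ext hij ▸ hj)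

lemma indep_tail_level (h : IsFrozenForest P ℓ c U Y) (N : ℕ) :
    Indep (forestTail ℓ U Y) (sigmaOn Y {j | ℓ j = N} ⊔ sigmaOn U {j | ℓ j < N}) P := by
  have hsup : ∀ s : Finset {j // ℓ j = N},
      sigmaOn U {j | ℓ j < N} ⊔ sigmaOn Y (Subtype.val '' (s : Set {j // ℓ j = N}))
        ≤ ⨆ s : Finset {j // ℓ j = N},
          sigmaOn U {j | ℓ j < N} ⊔ sigmaOn Y (Subtype.val '' (s : Set {j // ℓ j = N})) :=
    fun s => le_iSup (fun s : Finset {j // ℓ j = N} =>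
      sigmaOn U {j | ℓ j < N} ⊔ sigmaOn Y (Subtype.val '' (s : Set {j // ℓ j = N}))) s
  have hind : Indep (⨆ s : Finset {j // ℓ j = N},
      sigmaOn U {j | ℓ j < N} ⊔ sigmaOn Y (Subtype.val '' (s : Set {j // ℓ j = N})))
      (forestTail ℓ U Y) P := by
    refine indep_iSup_of_directed_le (fun s => (h.indep_tail_finset s).symm)
      (fun s => sup_le (sigmaOn_le h.measurable_weight _) (sigmaOn_le h.measurable_time _))
      h.forestTail_le (Monotone.directed_le fun s t hst => ?_)
    exact sup_le_sup_left (sigmaOn_mono (Set.image_mono (Finset.coe_subset.2 hst))) _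
  refine (indep_of_indep_of_le_left hind (sup_le ?_ ?_)).symm
  · refine sigmaOn_le_iff.2 fun j hj => Measurable.mono (measurable_sigmaOn ?_)
      (le_sup_right.trans (hsup {⟨j, hj⟩})) le_rfl
    exact ⟨⟨j, hj⟩, by simp, rfl⟩
  · exact le_sup_left.trans (hsup ∅)

/-- The tail of a forest is independent of all levels, hence of itself. -/
theorem isTrivialUnder_tail (h : IsFrozenForest P ℓ c U Y) :
    IsTrivialUnder P (forestTail ℓ U Y) := by
  have h1 := indep_iSup_of_monotone (fun k => (indep_aeClosure_right
      (h.indep_tail_level (0 + k))).symm) (fun _ => aeClosure_le _) h.forestTail_le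
    (by simpa using h.monotone_aeClosure (B := Set.univ) (n := 0) fun _ _ => trivial)
  have h2 := h.le_iSup_aeClosure Set.univ 0
  simp only [Set.mem_univ, true_and] at h2
  refine fun A hA => measure_eq_zero_or_one_of_indep_self (indep_of_indep_of_le_left h1 ?_) hA
  exact ((forestTail_le_level ℓ U Y 0).trans
    (sup_le_sup_left (sigmaOn_mono (Set.subset_univ _)) _)).trans h2

end IsFrozenForest

lemma IsTrivialUnder.mono {Ω : Type*} {m m' : MeasurableSpace Ω} [MeasurableSpace Ω] {P : Measure Ω}
    (h : IsTrivialUnder P m') (hle : m ≤ m') : IsTrivialUnder P m :=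
  fun A hA => h A (hle A hA)

lemma sigmaOn_le_comap {Ω J K β : Type*} [MeasurableSpace β] {X : J → Ω → β} {S : Set J}
    {Z : K → Ω → β} (h : ∀ j ∈ S, ∃ k, Z k = X j) :
    sigmaOn X S ≤ MeasurableSpace.comap (fun ω k => Z k ω) inferInstance := by
  refine sigmaOn_le_iff.2 fun j hj => ?_
  obtain ⟨k, hk⟩ := h j hj
  rw [← hk]
  exact (measurable_pi_apply k).comp (comap_measurable fun ω k => Z k ω)

/-! ### The binary tree of words -/

section Words

variable {Ω : Type*} [MeasurableSpace Ω] {P : Measure Ω} {U : List (Fin 2) → Ω → unitInterval}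
  {Y : List (Fin 2) → Ω → I}

lemma IsInvariantRTP.isFrozenForest (h : IsInvariantRTP P frozenMap volume ν U Y) :
    IsFrozenForest P List.length (fun i k => i ++ [k]) U Y where
  level_child i k := by simp
  child_injective i i' k k' hk := by simpa using hk
  measurable_weight := h.measurable_innovation
  measurable_time := h.measurable_process
  law_weight := h.law_innovation
  indep_weight := h.indep_innovation
  law_time := h.law_process
  indep_level := h.indep_generation
  recursion := h.recursion
  indep_earlier n := indep_of_indep_of_le ((IndepFun_iff_Indep _ _ _).1 (h.indep_earlier n))
    (sigmaOn_le_comap (Z := fun (i : {i : List (Fin 2) // i.length = n}) => Y i.1)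
      fun j hj => ⟨⟨j, hj⟩, rfl⟩)
    (sigmaOn_le_comap (Z := fun (i : {i : List (Fin 2) // i.length < n}) => U i.1)
      fun j hj => ⟨⟨j, hj⟩, rfl⟩)

theorem IsInvariantRTP.isTrivialUnder_rtpTail [IsProbabilityMeasure P]
    (h : IsInvariantRTP P frozenMap volume ν U Y) : IsTrivialUnder P (rtpTail Y) :=
  h.isFrozenForest.isTrivialUnder_tail.mono (iInf_mono fun _ => le_sup_left)

end Words

/-! ### The 3-regular tree -/

section Tree

variable {V : Type*} {G : SimpleGraph V}

/-- In a tree, a vertex other than `o` has only one neighbour that is closer to `o`. -/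
lemma eq_of_adj_of_dist_eq (hG : G.IsTree) {o v v' w : V} (hv : G.Adj v w) (hv' : G.Adj v' w)
    (hd : G.dist o w = G.dist o v + 1) (hd' : G.dist o w = G.dist o v' + 1) : v = v' := by
  obtain ⟨p, hp⟩ := hG.connected.exists_walk_length_eq_dist o v
  obtain ⟨p', hp'⟩ := hG.connected.exists_walk_length_eq_dist o v'
  have h1 : (p.concat hv).IsPath := SimpleGraph.Walk.isPath_of_length_eq_dist _ (by simp [hp, hd])
  have h2 : (p'.concat hv').IsPath :=
    SimpleGraph.Walk.isPath_of_length_eq_dist _ (by simp [hp', hd'])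
  have h3 := congrArg SimpleGraph.Walk.penultimate ((hG.existsUnique_path o w).unique h1 h2)
  simpa using h3

/-- The directed edges of `G` that point away from the vertex `o`. -/
abbrev OutwardDart (G : SimpleGraph V) (o : V) : Type _ :=
  {d : G.Dart // G.dist o d.snd = G.dist o d.fst + 1}

lemma OutwardDart.eq_of_snd_eq (hG : G.IsTree) {o : V} {d d' : OutwardDart G o}
    (h : d.1.snd = d'.1.snd) : d = d' := by
  have h1 : d.1.fst = d'.1.fst :=
    eq_of_adj_of_dist_eq hG (o := o) d.1.adj (h ▸ d'.1.adj) d.2 (h ▸ d'.2)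
  exact Subtype.ext (SimpleGraph.Dart.ext _ _ (Prod.ext h1 h))

lemma OutwardDart.edge_injective (o : V) : Function.Injective
    (fun d : OutwardDart G o => (⟨d.1.edge, d.1.edge_mem⟩ : G.edgeSet)) := by
  intro d d' h
  have h1 : d.1.edge = d'.1.edge := congrArg Subtype.val h
  rcases (SimpleGraph.dart_edge_eq_iff _ _).1 h1 with h2 | h2
  · exact Subtype.ext h2
  · have h3 := d.2
    have h4 := d'.2
    rw [h2] at h3
    simp only [SimpleGraph.Dart.symm_toProd, Prod.fst_swap, Prod.snd_swap] at h3
    omega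

lemma exists_children [G.LocallyFinite] (hG : G.IsTree) (h3 : G.IsRegularOfDegree 3) {o : V}
    (d : OutwardDart G o) : ∃ f : Fin 2 → OutwardDart G o, f 0 ≠ f 1 ∧
      ∀ k, (f k).1.fst = d.1.snd ∧ (f k).1 ≠ d.1.symm := by
  classical
  have hmem : d.1.fst ∈ G.neighborFinset d.1.snd := by
    rw [SimpleGraph.mem_neighborFinset]; exact d.1.adj.symm
  have hcard : ((G.neighborFinset d.1.snd).erase d.1.fst).card = 2 := by
    rw [Finset.card_erase_of_mem hmem, SimpleGraph.card_neighborFinset_eq_degree, h3]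
  obtain ⟨a, b, hab, heq⟩ := Finset.card_eq_two.1 hcard
  have key : ∀ x ∈ ((G.neighborFinset d.1.snd).erase d.1.fst),
      ∃ e : OutwardDart G o, e.1.fst = d.1.snd ∧ e.1.snd = x ∧ e.1 ≠ d.1.symm := by
    intro x hx
    rw [Finset.mem_erase, SimpleGraph.mem_neighborFinset] at hx
    refine ⟨⟨⟨(d.1.snd, x), hx.2⟩, ?_⟩, rfl, rfl, fun he => hx.1 ?_⟩
    · rcases hG.dist_eq_dist_add_one_of_adj o hx.2 with h | h
      · exact absurd (eq_of_adj_of_dist_eq hG hx.2.symm d.1.adj h d.2) hx.1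
      · exact h
    · exact congrArg (fun e : G.Dart => e.snd) he
  obtain ⟨e, he1, he2, he3⟩ := key a (by simp [heq])
  obtain ⟨e', he1', he2', he3'⟩ := key b (by simp [heq])
  refine ⟨![e, e'], fun h => hab ?_, fun k => ?_⟩
  · rw [← he2, ← he2']
    exact congrArg (fun e : OutwardDart G o => e.1.snd) h
  · fin_cases k
    · exact ⟨he1, he3⟩
    · exact ⟨he1', he3'⟩

variable {Ω : Type*} [MeasurableSpace Ω] {P : Measure Ω} {U : G.edgeSet → Ω → unitInterval}
  {Y : G.Dart → Ω → I}

/-- Seen from `o`, Aldous' construction is a forest of three binary trees. -/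
lemma IsAldousConstruction.exists_isFrozenForest [G.LocallyFinite] (hG : G.IsTree)
    (h3 : G.IsRegularOfDegree 3) (h : IsAldousConstruction P G U Y) (o : V) :
    ∃ c : OutwardDart G o → Fin 2 → OutwardDart G o,
      IsFrozenForest P (fun d => G.dist o d.1.fst) c (fun d => U ⟨d.1.edge, d.1.edge_mem⟩)
        (fun d => Y d.1) := by
  choose c hc hcd using fun d : OutwardDart G o => exists_children hG h3 d
  have hinj : ∀ d k k', c d k = c d k' → k = k' := by
    intro d k k' hk
    fin_cases k <;> fin_cases k'
    · rfl
    · exact absurd hk (hc d)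
    · exact absurd hk.symm (hc d)
    · rfl
  refine ⟨c, ?_, ?_, fun _ => h.measurable_weight _, fun _ => h.measurable_time _,
    fun _ => h.law_weight _, h.indep_weight.precomp (OutwardDart.edge_injective o),
    fun _ => h.law_time _, fun n => ?_, fun d => ?_, fun n => ?_⟩
  · intro d k
    rw [(hcd d k).1, d.2]
  · intro d d' k k' hk
    have h1 : d = d' := OutwardDart.eq_of_snd_eq hG (by rw [← (hcd d k).1, ← (hcd d' k').1, hk])
    subst h1
    exact ⟨rfl, hinj _ _ _ hk⟩
  · exact (h.indep_sphere o n).precomp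
      (g := fun j : {d : OutwardDart G o // G.dist o d.1.fst = n} =>
        (⟨j.1.1, j.2, by rw [j.1.2, j.2]⟩ : {d : G.Dart // IsOutward G o n d}))
      fun j j' hjj => Subtype.ext (Subtype.ext (congrArg (fun d => d.1) hjj))
  · exact h.recursion d.1 (c d 0).1 (c d 1).1 (hcd d 0).1 (hcd d 1).1 (hcd d 0).2 (hcd d 1).2
      fun he => hc d (Subtype.ext he)
  · refine indep_of_indep_of_le ((IndepFun_iff_Indep _ _ _).1 (h.indep_inside o n))
      (sigmaOn_le_comap (Z := fun (d : {d : G.Dart // IsOutward G o n d}) => Y d.1)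
        fun d (hd : G.dist o d.1.fst = n) => ⟨⟨d.1, hd, by rw [d.2, hd]⟩, rfl⟩)
      (sigmaOn_le_comap (Z := fun (e : {e : G.edgeSet // ∀ v ∈ e.1, G.dist o v ≤ n}) => U e.1)
        fun d (hd : G.dist o d.1.fst < n) => ⟨⟨⟨d.1.edge, d.1.edge_mem⟩, fun v hv => ?_⟩, rfl⟩)
    have h2 := d.2
    rcases Sym2.mem_iff.1 hv with rfl | rfl <;> omega

theorem IsAldousConstruction.isTrivialUnder_aldousTail [IsProbabilityMeasure P] [G.LocallyFinite]
    (hG : G.IsTree) (h3 : G.IsRegularOfDegree 3) (h : IsAldousConstruction P G U Y) (o : V) :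
    IsTrivialUnder P (aldousTail G U Y o) := by
  obtain ⟨c, hc⟩ := h.exists_isFrozenForest hG h3 o
  refine hc.isTrivialUnder_tail.mono (iInf_mono fun n => ?_)
  refine iSup_le fun m => iSup_le fun hm => iSup_le fun d => iSup_le fun hd => ?_
  have hd' : G.dist o d.snd = G.dist o d.fst + 1 := by rw [hd.1, hd.2]
  have hn : n ≤ G.dist o d.fst := by rw [hd.1]; exact hm
  exact sup_le_sup
    (measurable_sigmaOn (X := fun d : OutwardDart G o => Y d.1) (j := ⟨d, hd'⟩) hn).comap_le
    (measurable_sigmaOn (X := fun d : OutwardDart G o => U ⟨d.1.edge, d.1.edge_mem⟩)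
      (j := ⟨d, hd'⟩) hn).comap_le

end Tree

end FrozenPercolation

theorem mainTheorem2 {Ω : Type*} [MeasurableSpace Ω] (P : Measure Ω) [IsProbabilityMeasure P] :
    (∀ (U : List (Fin 2) → Ω → unitInterval) (Y : List (Fin 2) → Ω → FrozenPercolation.I),
      FrozenPercolation.IsInvariantRTP P FrozenPercolation.frozenMap volume
        FrozenPercolation.ν U Y →
      FrozenPercolation.IsTrivialUnder P (FrozenPercolation.rtpTail Y)) ∧
    (∀ (V : Type*) (G : SimpleGraph V) [G.LocallyFinite],
      G.IsTree → G.IsRegularOfDegree 3 →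
      ∀ (U : G.edgeSet → Ω → unitInterval) (Y : G.Dart → Ω → FrozenPercolation.I),
        FrozenPercolation.IsAldousConstruction P G U Y →
        ∀ o : V, FrozenPercolation.IsTrivialUnder P (FrozenPercolation.aldousTail G U Y o)) :=
  ⟨fun _ _ h => h.isTrivialUnder_rtpTail,
    fun _ _ _ hG h3 _ _ h o => h.isTrivialUnder_aldousTail hG h3 o⟩
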